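/- For every integer $n\ge 0$ let $$A_\delta(n)=\sum_{k=0}^{n}(-1)^k\,3^{\,n-3k}\binom{n}{3k}\binom{n+k}{n}\frac{(3k)!}{k!^3}$$ (terms with $3k>n$ being $0$, since then $\binom{n}{3k}=0$) be the sporadic sequence $(\delta)$ of Almkvist and Zudilin; its values are integers. Then for every prime $p\ge 5$ and all integers $m,r\ge 1$, $$A_\delta(mp^r)\equiv A_\delta(mp^{r-1})\pmod{p^{3r}}.$$ -/

import Mathlib

open Nat

/-- The number `k!^3` divides `(3k)!`, so the natural-number division in `Adelta` is exact. -/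
theorem factorial_pow_three_dvd (k : ℕ) : k ! ^ 3 ∣ (3 * k)! := by
  have h1 : k ! * k ! ∣ (k + k)! := Nat.factorial_mul_factorial_dvd_factorial_add k k
  have h2 : (k + k)! * k ! ∣ (k + k + k)! :=
    Nat.factorial_mul_factorial_dvd_factorial_add (k + k) k
  have h3 : 3 * k = k + k + k := by ring
  have h4 : k ! ^ 3 = k ! * k ! * k ! := by ring
  rw [h3, h4]
  exact (Nat.mul_dvd_mul_right h1 _).trans h2

/-- The sporadic sequence `(δ)` of Almkvist and Zudilin,
`A_δ(n) = ∑_{k=0}^{n} (-1)^k 3^(n-3k) C(n,3k) C(n+k,n) (3k)!/k!^3`.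
The terms with `3k > n` vanish because `C(n,3k) = 0`, so the truncated exponent `n - 3k` is only
relevant when `3k ≤ n`; the quotient `(3k)!/k!^3` is an integer. -/
def Adelta (n : ℕ) : ℤ :=
  ∑ k ∈ Finset.range (n + 1),
    (-1) ^ k * 3 ^ (n - 3 * k) * (n.choose (3 * k) : ℤ) * ((n + k).choose n : ℤ) *
      (((3 * k)! / k ! ^ 3 : ℕ) : ℤ)

/-! Up to the sign $(-1)^n$, $A_\delta(n)$ is the coefficient of $(y_0y_1y_2y_3)^n$ in $\prod_k
F_k^n$, where the $F_k$ are the linear forms given by the rows of a skew conference matrix of order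
four (`Adelta_eq_confCoeff`). By MacMahon's master theorem these are the diagonal coefficients of
$1/(1+e_2+9e_4)$. Expanding this series gives a Legendre-type transform of Zagier's sequence C, and
creative telescoping shows that the transform, with sign, has the same second-order recurrence and
initial values as $A_\delta$.

For the congruence, let $p^r \mid pn$ and split each $F_k^{pn}$ into a section (exponents all
divisible by $p$) and a rest. Expand the product over the four rows by the set of rows that
contribute their rest.

No rest: after dividing exponents by $p$, each term is compared with the corresponding term of
$\prod_k F_k^n$. Ratios of multinomial coefficients are ratios of products of integers prime to $p$,
controlled by a Jacobsthal-type congruence (`coprimeFactorial_add_add`,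
`pow_dvd_prod_rowCoeff_sub`).

One rest: the contribution is zero, since the target exponent is divisible by $p$. Three or more:
each rest has coefficients divisible by $p^r$, which suffices.

Two rests: the trivial bound is only $p^{2r}$. Orthogonality of the two rows produces an alternating
sum over indices $a$ prime to $p$, essentially a weighted sum of $(-1)^a/a^2$, which cancels under
reflection. This gain and the divisibility of the section coefficients give $p^{3r}$
(`pow_dvd_choose_mul_sum`, `pow_dvd_coeff_pair`). -/

/-! ### Reciprocal factorials. -/

/-- The reciprocal factorial on the integers, equal to `0` at negative integers. -/
def ifact (m : ℤ) : ℚ := if m < 0 then 0 else 1 / (m.toNat ! : ℚ)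

theorem ifact_of_neg {m : ℤ} (h : m < 0) : ifact m = 0 := if_pos h

theorem ifact_natCast (m : ℕ) : ifact m = 1 / (m ! : ℚ) := by
  simp [ifact]

/-- Valid at every integer, including $m = 0$ where both sides vanish. Hence the telescoping
identities below reduce to `ring` with no cases at the ends of the summation range. -/
theorem ifact_pred (m : ℤ) : ifact (m - 1) = m * ifact m := by
  rcases lt_trichotomy m 0 with h | rfl | h
  · rw [ifact_of_neg h, ifact_of_neg (by omega), mul_zero]
  · simp [ifact]
  · obtain ⟨k, rfl⟩ : ∃ k : ℕ, m = (k : ℤ) + 1 := ⟨(m - 1).toNat, by omega⟩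
    have h1 : ((k : ℤ) + 1) = ((k + 1 : ℕ) : ℤ) := by push_cast; ring
    rw [add_sub_cancel_right, h1, ifact_natCast, ifact_natCast, Nat.factorial_succ]
    have : (k ! : ℚ) ≠ 0 := by exact_mod_cast Nat.factorial_ne_zero k
    have h2 : ((k : ℚ) + 1) ≠ 0 := by positivity
    push_cast
    field_simp

theorem ifact_eq_succ (m : ℤ) : ifact m = (m + 1) * ifact (m + 1) := by
  have := ifact_pred (m + 1)
  rw [add_sub_cancel_right] at this
  rw [this]
  push_cast
  ring

theorem choose_eq_ifact (n k : ℕ) :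
    (n.choose k : ℚ) = n ! * ifact (n - k) * ifact k := by
  rcases lt_or_ge n k with h | h
  · rw [Nat.choose_eq_zero_of_lt h, ifact_of_neg (by omega)]
    simp
  · rw [Nat.choose_eq_factorial_div_factorial h,
      Nat.cast_div (Nat.factorial_mul_factorial_dvd_factorial h) (by positivity),
      show (n : ℤ) - k = ((n - k : ℕ) : ℤ) by omega, ifact_natCast, ifact_natCast]
    push_cast
    field_simp

/-! ### Zagier's sequence C and its recurrence. -/

/-- Zagier's sporadic sequence `C`, `∑ C(N,i)² C(2i,i)`. -/
def zagierC (N : ℕ) : ℤ :=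
  ∑ i ∈ Finset.range (N + 1), (N.choose i : ℤ) ^ 2 * ((2 * i).choose i : ℤ)

/-- The summand of `zagierC`. -/
def zagierCTerm (N i : ℕ) : ℚ :=
  (N ! : ℚ) ^ 2 * (2 * i)! * ifact (N - i) ^ 2 * ifact i ^ 4

theorem zagierC_eq_sum_term (N K : ℕ) (h : N < K) :
    (zagierC N : ℚ) = ∑ i ∈ Finset.range K, zagierCTerm N i := by
  have hterm : ∀ i, zagierCTerm N i = (N.choose i : ℚ) ^ 2 * ((2 * i).choose i : ℚ) := by
    intro i
    rw [zagierCTerm, choose_eq_ifact, choose_eq_ifact,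
      show ((2 * i : ℕ) : ℤ) - i = (i : ℤ) by push_cast; ring]
    ring
  rw [zagierC]
  push_cast
  rw [Finset.sum_subset (Finset.range_subset_range.2 h)]
  · exact Finset.sum_congr rfl fun i _ => (hterm i).symm
  · intro i _ hi
    rw [Nat.choose_eq_zero_of_lt (by simpa using hi)]
    simp

/-- The telescoping certificate for `zagierC`. -/
def zagierCCert (N i : ℕ) : ℚ :=
  (i : ℚ) ^ 3 * ((N + 1) ^ 2 * (3 * i - 4 * N - 8)) *
    ((N ! : ℚ) ^ 2 * (2 * i)! * ifact (N + 2 - i) ^ 2 * ifact i ^ 4)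

/-- Zeilberger's method: once all reciprocal factorials are expressed through `ifact (N + 2 - i)`
and `ifact (i + 1)`, a common factor remains and the claim is a polynomial identity. -/
theorem zagierCTerm_telescope (N i : ℕ) :
    ((N : ℚ) + 2) ^ 2 * zagierCTerm (N + 2) i -
        (10 * ((N : ℚ) + 1) ^ 2 + 10 * (N + 1) + 3) * zagierCTerm (N + 1) i +
        9 * ((N : ℚ) + 1) ^ 2 * zagierCTerm N i =
      zagierCCert N (i + 1) - zagierCCert N i := by
  have e1 : ifact ((N : ℤ) + 1 - i) = ((N : ℚ) + 2 - i) * ifact (N + 2 - i) := by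
    rw [ifact_eq_succ, show (N : ℤ) + 1 - i + 1 = N + 2 - i by ring]; push_cast; ring
  have e2 : ifact ((N : ℤ) - i) = ((N : ℚ) + 1 - i) * (((N : ℚ) + 2 - i) * ifact (N + 2 - i)) := by
    rw [ifact_eq_succ, show (N : ℤ) - i + 1 = N + 1 - i by ring, e1]; push_cast; ring
  have e3 : ifact ((N : ℤ) + 2 - (i + 1)) = ((N : ℚ) + 2 - i) * ifact (N + 2 - i) := by
    rw [← e1]; congr 1; ring
  have e4 : ifact (i : ℤ) = ((i : ℚ) + 1) * ifact ((i : ℤ) + 1) := by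
    rw [ifact_eq_succ]; push_cast; ring
  simp only [zagierCTerm, zagierCCert, Nat.cast_add, Nat.cast_one, Nat.cast_ofNat, e1, e2, e3, e4,
    show 2 * (i + 1) = 2 * i + 1 + 1 by ring, Nat.factorial_succ, Nat.cast_mul]
  ring

theorem zagierC_recurrence (N : ℕ) :
    ((N : ℚ) + 2) ^ 2 * zagierC (N + 2) =
      (10 * ((N : ℚ) + 1) ^ 2 + 10 * (N + 1) + 3) * zagierC (N + 1) -
        9 * ((N : ℚ) + 1) ^ 2 * zagierC N := by
  have h := Finset.sum_congr rfl fun i (_ : i ∈ Finset.range (N + 3)) => zagierCTerm_telescope N i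
  rw [Finset.sum_range_sub, Finset.sum_add_distrib, Finset.sum_sub_distrib, ← Finset.mul_sum,
    ← Finset.mul_sum, ← Finset.mul_sum, ← zagierC_eq_sum_term _ _ (by omega),
    ← zagierC_eq_sum_term _ _ (by omega), ← zagierC_eq_sum_term _ _ (by omega)] at h
  have h0 : zagierCCert N 0 = 0 := by simp [zagierCCert]
  have h1 : zagierCCert N (N + 3) = 0 := by
    rw [zagierCCert, ifact_of_neg (m := (N : ℤ) + 2 - (N + 3 : ℕ)) (by push_cast; omega)]
    ring
  rw [h0, h1] at h
  linarith

/-! ### The recurrence of the sequence (δ). -/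

/-- The summand of `Adelta`. -/
def adeltaTerm (n k : ℕ) : ℚ :=
  (-1) ^ k * (3 : ℚ) ^ ((n : ℤ) - 3 * k) * (n + k)! * ifact (n - 3 * k) * ifact k ^ 4

theorem Adelta_eq_sum_term (n K : ℕ) (h : n < K) :
    (Adelta n : ℚ) = ∑ k ∈ Finset.range K, adeltaTerm n k := by
  have hterm : ∀ k, adeltaTerm n k = (-1) ^ k * 3 ^ (n - 3 * k) * (n.choose (3 * k) : ℚ) *
      ((n + k).choose n : ℚ) * (((3 * k)! / k ! ^ 3 : ℕ) : ℚ) := by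
    intro k
    have hn : (n ! : ℚ) * ifact n = 1 := by
      rw [ifact_natCast]; field_simp
    have h3 : ((3 * k)! : ℚ) * ifact ((3 * k : ℕ) : ℤ) = 1 := by
      rw [ifact_natCast]; field_simp
    rw [adeltaTerm, choose_eq_ifact, choose_eq_ifact, Nat.cast_div (factorial_pow_three_dvd k)
      (by positivity), show ((n + k : ℕ) : ℤ) - n = (k : ℤ) by push_cast; ring]
    have hk : ((k ! : ℚ) ^ 3)⁻¹ = ifact k ^ 3 := by rw [ifact_natCast]; field_simp
    rw [div_eq_mul_inv]
    push_cast at h3 ⊢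
    rw [hk]
    rcases lt_or_ge n (3 * k) with h | h
    · rw [ifact_of_neg (by omega)]; simp
    · rw [show (3 : ℚ) ^ ((n : ℤ) - 3 * k) = 3 ^ (n - 3 * k) by
        rw [← zpow_natCast]; congr 1; omega]
      linear_combination (-(-1) ^ k * 3 ^ (n - 3 * k) * ((n + k)! : ℚ) * ifact (n - 3 * k) *
        ifact k ^ 4) * (hn + h3 * ((n ! : ℚ) * ifact n))
  rw [Adelta]
  push_cast
  rw [Finset.sum_subset (Finset.range_subset_range.2 h)]
  · exact Finset.sum_congr rfl fun k _ => by rw [hterm]; rfl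
  · intro k _ hk
    rw [Nat.choose_eq_zero_of_lt (by simp at hk; omega)]
    simp

/-- The telescoping certificate for `Adelta`. -/
def adeltaCert (n k : ℕ) : ℚ :=
  (k : ℚ) ^ 4 * (-324 * (4 * n + 5)) *
    ((-1) ^ k * (3 : ℚ) ^ ((n : ℤ) - 3 * k) * (n + k)! * ifact (n + 2 - 3 * k) * ifact k ^ 4)

/-- Again a polynomial identity after extracting a common factor. The integer exponent of 3 in
`adeltaTerm` makes the shift in $k$ a division by 27 even when $3k > n$. -/
theorem adeltaTerm_telescope (n k : ℕ) :
    ((n : ℚ) + 2) ^ 3 * adeltaTerm (n + 2) k -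
        (2 * n + 3) * (7 * ((n : ℚ) + 1) ^ 2 + 7 * (n + 1) + 3) * adeltaTerm (n + 1) k +
        81 * ((n : ℚ) + 1) ^ 3 * adeltaTerm n k =
      adeltaCert n (k + 1) - adeltaCert n k := by
  have e1 : ifact ((n : ℤ) + 1 - 3 * k) = ((n : ℚ) + 2 - 3 * k) * ifact (n + 2 - 3 * k) := by
    rw [ifact_eq_succ, show (n : ℤ) + 1 - 3 * k + 1 = n + 2 - 3 * k by ring]; push_cast; ring
  have e2 : ifact ((n : ℤ) - 3 * k) =
      ((n : ℚ) + 1 - 3 * k) * (((n : ℚ) + 2 - 3 * k) * ifact (n + 2 - 3 * k)) := by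
    rw [ifact_eq_succ, show (n : ℤ) - 3 * k + 1 = n + 1 - 3 * k by ring, e1]; push_cast; ring
  have e3 : ifact ((n : ℤ) + 2 - 3 * (k + 1)) =
      ((n : ℚ) - 3 * k) * (((n : ℚ) + 1 - 3 * k) * (((n : ℚ) + 2 - 3 * k) *
        ifact (n + 2 - 3 * k))) := by
    rw [ifact_eq_succ, show (n : ℤ) + 2 - 3 * (k + 1) + 1 = n - 3 * k by ring, e2]
    push_cast; ring
  have e4 : ifact (k : ℤ) = ((k : ℚ) + 1) * ifact ((k : ℤ) + 1) := by
    rw [ifact_eq_succ]; push_cast; ring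
  have z1 : (3 : ℚ) ^ ((n : ℤ) + 1 - 3 * k) = 3 * 3 ^ ((n : ℤ) - 3 * k) := by
    rw [show (n : ℤ) + 1 - 3 * k = n - 3 * k + 1 by ring, zpow_add₀ (by norm_num)]; ring
  have z2 : (3 : ℚ) ^ ((n : ℤ) + 2 - 3 * k) = 9 * 3 ^ ((n : ℤ) - 3 * k) := by
    rw [show (n : ℤ) + 2 - 3 * k = n - 3 * k + 2 by ring, zpow_add₀ (by norm_num)]; norm_num; ring
  have z3 : (3 : ℚ) ^ ((n : ℤ) - 3 * (k + 1)) = 3 ^ ((n : ℤ) - 3 * k) / 27 := by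
    rw [show (n : ℤ) - 3 * (k + 1) = n - 3 * k + (-3) by ring, zpow_add₀ (by norm_num)]
    norm_num; ring
  simp only [adeltaTerm, adeltaCert, Nat.cast_add, Nat.cast_one, Nat.cast_ofNat, e1, e2, e3, e4,
    z1, z2, z3, show n + (k + 1) = n + k + 1 by ring, show n + 1 + k = n + k + 1 by ring,
    show n + 2 + k = n + k + 1 + 1 by ring, Nat.factorial_succ, Nat.cast_mul, pow_succ]
  ring

theorem Adelta_recurrence (n : ℕ) :
    ((n : ℚ) + 2) ^ 3 * Adelta (n + 2) =
      (2 * n + 3) * (7 * ((n : ℚ) + 1) ^ 2 + 7 * (n + 1) + 3) * Adelta (n + 1) -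
        81 * ((n : ℚ) + 1) ^ 3 * Adelta n := by
  have h := Finset.sum_congr rfl fun i (_ : i ∈ Finset.range (n + 3)) => adeltaTerm_telescope n i
  rw [Finset.sum_range_sub, Finset.sum_add_distrib, Finset.sum_sub_distrib, ← Finset.mul_sum,
    ← Finset.mul_sum, ← Finset.mul_sum, ← Adelta_eq_sum_term _ _ (by omega),
    ← Adelta_eq_sum_term _ _ (by omega), ← Adelta_eq_sum_term _ _ (by omega)] at h
  have h0 : adeltaCert n 0 = 0 := by simp [adeltaCert]
  have h1 : adeltaCert n (n + 3) = 0 := by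
    rw [adeltaCert, ifact_of_neg (m := (n : ℤ) + 2 - 3 * (n + 3 : ℕ)) (by push_cast; omega)]
    ring
  rw [h0, h1] at h
  linarith

/-! ### The Legendre-type transform of Zagier's sequence. -/

/-- The Legendre-type transform of `zagierC`. -/
def legendreZagierC (n : ℕ) : ℤ :=
  ∑ N ∈ Finset.range (n + 1),
    (-9) ^ (n - N) * ((n + N).choose (2 * N) : ℤ) * ((2 * N).choose N : ℤ) * zagierC N

/-- The summand of `(-1) ^ n * legendreZagierC n`, without the factor `zagierC N`. -/
def legendreKernel (n N : ℕ) : ℚ :=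
  9 ^ n * (-1 / 9) ^ N * (n + N)! * ifact (n - N) * ifact N ^ 2

theorem legendreZagierC_eq_sum (n K : ℕ) (h : n < K) :
    (-1) ^ n * (legendreZagierC n : ℚ) =
      ∑ N ∈ Finset.range K, legendreKernel n N * zagierC N := by
  have hterm : ∀ N ≤ n, legendreKernel n N = (-1) ^ n * ((-9) ^ (n - N) *
      ((n + N).choose (2 * N) : ℚ) * ((2 * N).choose N : ℚ)) := by
    intro N hN
    have h3 : ((2 * N)! : ℚ) * ifact (2 * N) = 1 := by
      rw [show (2 : ℤ) * N = (2 * N : ℕ) by push_cast; ring, ifact_natCast]; field_simp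
    obtain ⟨d, rfl⟩ := Nat.exists_eq_add_of_le hN
    rw [legendreKernel, choose_eq_ifact, choose_eq_ifact, Nat.add_sub_cancel_left,
      show ((N + d + N : ℕ) : ℤ) - (2 * N : ℕ) = ((N + d : ℕ) : ℤ) - N by push_cast; ring,
      show ((2 * N : ℕ) : ℤ) - N = N by push_cast; ring]
    have hs : (9 : ℚ) ^ (N + d) * (-1 / 9) ^ N = (-1) ^ (N + d) * (-9) ^ d := by
      rw [pow_add, pow_add, show (-9 : ℚ) = (-1) * 9 by norm_num, mul_pow, div_pow]
      have : ((-1 : ℚ) ^ d) * (-1) ^ d = 1 := by rw [← mul_pow]; norm_num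
      field_simp
      linear_combination -this
    push_cast
    linear_combination (((N + d + N)! : ℚ) * ifact (N + d - N) * ifact N ^ 2) * hs -
      ((-1) ^ (N + d) * (-9) ^ d * ((N + d + N)! : ℚ) * ifact (N + d - N) * ifact N ^ 2) * h3
  rw [legendreZagierC]
  push_cast
  rw [← Finset.sum_subset (Finset.range_subset_range.2 h), Finset.mul_sum]
  · refine Finset.sum_congr rfl fun N hN => ?_
    rw [hterm N (by simp at hN; omega)]
    ring
  · intro N _ hN
    rw [legendreKernel, ifact_of_neg (m := (n : ℤ) - N) (by simp at hN; omega)]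
    simp

/-- The telescoping certificate for `legendreZagierC`; the argument is shifted by one. -/
def legendreCert (n N : ℕ) : ℚ :=
  9 ^ n * (-1 / 9) ^ (N + 1) * (n + N + 1)! * ifact (n + 1 - N) * ifact N ^ 2 *
    (-162 * (2 * n + 3)) *
    (((N : ℚ) + 1) ^ 2 * zagierC (N + 1) + (n + N + 2) * (n + 1 - N) * zagierC N)

/-- The summand is not hypergeometric, so the certificate combines two neighbouring values of
`zagierC`. Its difference involves `zagierC (N + 2)`, which `zagierC_recurrence` eliminates. -/
theorem legendreKernel_telescope (n N : ℕ) :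
    (((n : ℚ) + 2) ^ 3 * legendreKernel (n + 2) (N + 1) -
        (2 * n + 3) * (7 * ((n : ℚ) + 1) ^ 2 + 7 * (n + 1) + 3) * legendreKernel (n + 1) (N + 1) +
        81 * ((n : ℚ) + 1) ^ 3 * legendreKernel n (N + 1)) * zagierC (N + 1) =
      legendreCert n (N + 1) - legendreCert n N := by
  have e1 : ifact ((n : ℤ) + 1 - N) = ((n : ℚ) + 2 - N) * ifact (n + 2 - N) := by
    rw [ifact_eq_succ, show (n : ℤ) + 1 - N + 1 = n + 2 - N by ring]; push_cast; ring
  have e2 : ifact ((n : ℤ) - N) = ((n : ℚ) + 1 - N) * ifact (n + 1 - N) := by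
    rw [ifact_eq_succ, show (n : ℤ) - N + 1 = n + 1 - N by ring]; push_cast; ring
  have e2' : ifact ((n : ℤ) - (N + 1)) = ((n : ℚ) - N) * (((n : ℚ) + 1 - N) * ifact (n + 1 - N)) := by
    rw [ifact_eq_succ, show (n : ℤ) - (N + 1) + 1 = n - N by ring, e2]; push_cast; ring
  have e5 : ifact ((n : ℤ) + 2 - (N + 1)) = ifact (n + 1 - N) := by congr 1; ring
  have e6 : ifact ((n : ℤ) + 1 - (N + 1)) = ((n : ℚ) + 1 - N) * ifact (n + 1 - N) := by
    rw [← e2]; congr 1; ring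
  have e4 : ifact (N : ℤ) = ((N : ℚ) + 1) * ifact ((N : ℤ) + 1) := by
    rw [ifact_eq_succ]; push_cast; ring
  have hrec := zagierC_recurrence N
  simp only [legendreKernel, legendreCert, Nat.cast_add, Nat.cast_one, Nat.cast_ofNat, e2', e4,
    e5, e6, show n + (N + 1) = n + N + 1 by ring, show n + 1 + (N + 1) = n + N + 1 + 1 by ring,
    show n + 2 + (N + 1) = n + N + 1 + 1 + 1 by ring, Nat.factorial_succ, Nat.cast_mul, pow_succ]
  linear_combination (-(9 ^ n * ((-1 / 9) ^ N * (-1 / 9) * (-1 / 9)) * (((n : ℚ) + N + 1 + 1) *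
    (((n : ℚ) + N + 1) * ((n + N)! : ℚ))) * (((n : ℚ) + 1 - N) * ifact (n + 1 - N)) *
    (ifact ((N : ℤ) + 1)) ^ 2 * (-162 * (2 * n + 3)))) * hrec

theorem legendreZagierC_recurrence (n : ℕ) :
    ((n : ℚ) + 2) ^ 3 * ((-1) ^ (n + 2) * legendreZagierC (n + 2)) =
      (2 * n + 3) * (7 * ((n : ℚ) + 1) ^ 2 + 7 * (n + 1) + 3) *
          ((-1) ^ (n + 1) * legendreZagierC (n + 1)) -
        81 * ((n : ℚ) + 1) ^ 3 * ((-1) ^ n * legendreZagierC n) := by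
  set U := ((n : ℚ) + 2) ^ 3 with hU
  set V := (2 * (n : ℚ) + 3) * (7 * ((n : ℚ) + 1) ^ 2 + 7 * (n + 1) + 3) with hV
  set W := 81 * ((n : ℚ) + 1) ^ 3 with hW
  have h : ∑ N ∈ Finset.range (n + 2), (U * (legendreKernel (n + 2) (N + 1) * zagierC (N + 1)) -
      V * (legendreKernel (n + 1) (N + 1) * zagierC (N + 1)) +
      W * (legendreKernel n (N + 1) * zagierC (N + 1))) =
      ∑ N ∈ Finset.range (n + 2), (legendreCert n (N + 1) - legendreCert n N) :=
    Finset.sum_congr rfl fun N _ => by rw [← legendreKernel_telescope]; ring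
  rw [Finset.sum_range_sub] at h
  have h1 : legendreCert n (n + 2) = 0 := by
    rw [legendreCert, ifact_of_neg (m := (n : ℤ) + 1 - (n + 2 : ℕ)) (by push_cast; omega)]
    ring
  -- The telescoping identity covers only the indices $N+1$; the missing terms of index 0 are
  -- exactly the initial value of the certificate.
  have h0 : legendreCert n 0 =
      U * (legendreKernel (n + 2) 0 * zagierC 0) - V * (legendreKernel (n + 1) 0 * zagierC 0) +
        W * (legendreKernel n 0 * zagierC 0) := by
    have f0 : ∀ m : ℕ, (m ! : ℚ) * ifact m = 1 := fun m => by
      rw [ifact_natCast]; field_simp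
    have c0 : zagierC 0 = 1 := by decide
    have c1 : zagierC 1 = 3 := by decide
    have i0 : ifact 0 = 1 := by simp [ifact]
    have g0 := f0 n
    have g1 := f0 (n + 1)
    have g2 := f0 (n + 2)
    push_cast at g1 g2
    simp only [legendreCert, legendreKernel, Nat.cast_zero, sub_zero, add_zero, zero_add, c0, c1, i0,
      pow_zero, pow_succ, Nat.cast_add, Nat.cast_one, Nat.cast_ofNat, mul_one, one_mul,
      Int.cast_one, Int.cast_ofNat]
    rw [hU, hV, hW]
    linear_combination (9 ^ n * (-1 / 9) * (-162 * (2 * n + 3)) * (3 + (n + 2) * (n + 1)) +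
      (2 * n + 3) * (7 * ((n : ℚ) + 1) ^ 2 + 7 * (n + 1) + 3) * 9 ^ n * 9) * g1 -
      ((n : ℚ) + 2) ^ 3 * 9 ^ n * 81 * g2 - 81 * ((n : ℚ) + 1) ^ 3 * 9 ^ n * g0
  rw [h0, h1] at h
  rw [legendreZagierC_eq_sum _ (n + 3) (by omega), legendreZagierC_eq_sum _ (n + 3) (by omega),
    legendreZagierC_eq_sum _ (n + 3) (by omega), Finset.sum_range_succ' _ (n + 2),
    Finset.sum_range_succ' _ (n + 2), Finset.sum_range_succ' _ (n + 2)]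
  rw [Finset.sum_add_distrib, Finset.sum_sub_distrib, ← Finset.mul_sum, ← Finset.mul_sum,
    ← Finset.mul_sum] at h
  linarith

/-- The sporadic sequence `(δ)` as a Legendre-type transform of Zagier's sequence `C`. -/
theorem Adelta_eq_legendreZagierC (n : ℕ) : Adelta n = (-1) ^ n * legendreZagierC n := by
  have key : ∀ n : ℕ, (Adelta n : ℚ) = (-1) ^ n * legendreZagierC n ∧
      (Adelta (n + 1) : ℚ) = (-1) ^ (n + 1) * legendreZagierC (n + 1) := by
    intro n
    induction n with
    | zero =>
      have h1 : Adelta 0 = 1 := by decide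
      have h2 : Adelta 1 = 3 := by decide
      have h3 : legendreZagierC 0 = 1 := by decide
      have h4 : legendreZagierC 1 = -3 := by decide
      simp [h1, h2, h3, h4]
    | succ n ih =>
      refine ⟨ih.2, ?_⟩
      have hA := Adelta_recurrence n
      have hL := legendreZagierC_recurrence n
      rw [ih.1, ih.2, ← hL] at hA
      exact mul_left_cancel₀ (by positivity) hA
  exact_mod_cast (key n).1

/-! ### MacMahon's master theorem for a conference matrix of order four. -/

open MvPolynomial in
/-- Setting to zero the variables outside the support of `n` does not change the `n`-th
coefficient. -/
theorem coeff_aeval_kill {σ : Type*} (n : σ →₀ ℕ) (F : MvPolynomial σ ℤ) [DecidableEq σ] :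
    coeff n (aeval (fun i => if n i = 0 then 0 else X i : σ → MvPolynomial σ ℤ) F) =
      coeff n F := by
  induction F using MvPolynomial.induction_on' with
  | add p q hp hq => rw [map_add, coeff_add, coeff_add, hp, hq]
  | monomial d a =>
    rw [aeval_monomial]
    by_cases h : ∀ i ∈ d.support, n i ≠ 0
    · rw [Finsupp.prod, Finset.prod_congr rfl (g := fun i => (X i : MvPolynomial σ ℤ) ^ d i)
        fun i hi => by rw [if_neg (h i hi)]]
      rw [monomial_eq, Finsupp.prod, algebraMap_eq]
    · push Not at h
      obtain ⟨i, hi, h0⟩ := h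
      rw [Finsupp.prod, Finset.prod_eq_zero hi, mul_zero, coeff_zero, coeff_monomial, if_neg]
      · rintro rfl
        exact (Finsupp.mem_support_iff.1 hi) h0
      · rw [if_pos h0, zero_pow (Finsupp.mem_support_iff.1 hi)]

/-- A skew-symmetric conference matrix of order four. -/
def confSign : Fin 4 → Fin 4 → ℤ :=
  ![![0, 1, 1, 1], ![-1, 0, 1, -1], ![-1, -1, 0, 1], ![-1, 1, -1, 0]]

open MvPolynomial in
/-- The linear forms given by the rows of the conference matrix. -/
noncomputable def confForm (i : Fin 4) : MvPolynomial (Fin 4) ℤ := ∑ j, confSign i j • X j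

open MvPolynomial in
/-- The coefficient of `y ^ n` in the product of the powers `confForm i ^ n i`. -/
noncomputable def confCoeff (n : Fin 4 →₀ ℕ) : ℤ := coeff n (∏ i, confForm i ^ n i)

/-- The exponent of the squarefree monomial with support `s`. -/
noncomputable def sqfreeExp (s : Finset (Fin 4)) : Fin 4 →₀ ℕ := ∑ i ∈ s, Finsupp.single i 1

theorem sqfreeExp_apply (s : Finset (Fin 4)) (i : Fin 4) :
    sqfreeExp s i = if i ∈ s then 1 else 0 := by
  simp [sqfreeExp, Finsupp.finsetSum_apply, Finsupp.single_apply]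

-- Lowering the exponents on $s$ costs factors $X_i$ and removes factors `confForm i`. All shifted
-- values thus become coefficients at the same `n` of one common product times a small factor; the
-- cases `n i = 0` compensate for the truncation in `n i - 1`.
open MvPolynomial in
theorem confCoeff_sub_sqfreeExp (n : Fin 4 →₀ ℕ) (s : Finset (Fin 4)) :
    (if sqfreeExp s ≤ n then confCoeff (n - sqfreeExp s) else 0) =
      coeff n ((∏ i, confForm i ^ (n i - 1)) *
        ∏ i, if i ∈ s then (if n i = 0 then 0 else X i) else
          if n i = 0 then 1 else confForm i) := by
  split_ifs with h
  · have h1 : ∀ i ∈ s, n i ≠ 0 := fun i hi => by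
      have := h i
      rw [sqfreeExp_apply, if_pos hi] at this
      omega
    have h2 : (∏ i, if i ∈ s then (if n i = 0 then 0 else X i) else
          if n i = 0 then 1 else confForm i) = monomial (sqfreeExp s) 1 *
          ∏ i, if i ∈ s then 1 else if n i = 0 then 1 else confForm i := by
      have : (monomial (sqfreeExp s) 1 : MvPolynomial (Fin 4) ℤ) =
          ∏ i, if i ∈ s then X i else 1 := by
        rw [sqfreeExp, monomial_sum_one, Finset.prod_ite_mem, Finset.univ_inter]
        rfl
      rw [this, ← Finset.prod_mul_distrib]
      refine Finset.prod_congr rfl fun i _ => ?_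
      by_cases hi : i ∈ s
      · simp [hi, h1 i hi]
      · simp [hi]
    rw [h2, mul_left_comm, coeff_monomial_mul', if_pos h, one_mul, confCoeff,
      ← Finset.prod_mul_distrib]
    refine congrArg (coeff (n - sqfreeExp s)) (Finset.prod_congr rfl fun i _ => ?_)
    rw [Finsupp.tsub_apply, sqfreeExp_apply]
    by_cases hi : i ∈ s
    · simp [hi]
    · by_cases h0 : n i = 0
      · simp [h0]
      · simp only [hi, h0, if_false]
        rw [← pow_succ]
        congr 1
        omega
  · have : ∃ i ∈ s, n i = 0 := by
      by_contra! hc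
      refine h fun i => ?_
      rw [sqfreeExp_apply]
      split_ifs with hi
      · have := hc i hi
        omega
      · exact Nat.zero_le _
    obtain ⟨i, hi, h0⟩ := this
    have : (∏ i, if i ∈ s then (if n i = 0 then 0 else X i) else
        if n i = 0 then 1 else confForm i) = 0 :=
      Finset.prod_eq_zero (Finset.mem_univ i) (by simp [hi, h0])
    rw [this, mul_zero, coeff_zero]

open MvPolynomial in
theorem confForm_eq :
    confForm 0 = X 1 + X 2 + X 3 ∧ confForm 1 = -X 0 + X 2 - X 3 ∧
      confForm 2 = -X 0 - X 1 + X 3 ∧ confForm 3 = -X 0 + X 1 - X 2 := by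
  refine ⟨?_, ?_, ?_, ?_⟩ <;> simp [confForm, Fin.sum_univ_four, confSign] <;> ring

-- With $C$ the sign matrix and $F_i$ the forms, the sum comes from $\det(\mathrm{diag}(F) -
-- C\,\mathrm{diag}(X))$, which vanishes because the rows add up to $F_i - \sum_j C_{ij}X_j = 0$.
-- The coefficients 1 and 9 are the principal minors of $C$ of orders 2 and 4; those of odd order
-- vanish by skew symmetry.
open MvPolynomial in
theorem confCoeff_recurrence (n : Fin 4 →₀ ℕ) (hn : n ≠ 0) :
    let c := fun s => if sqfreeExp s ≤ n then confCoeff (n - sqfreeExp s) else 0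
    c ∅ + (c {0, 1} + c {0, 2} + c {0, 3} + c {1, 2} + c {1, 3} + c {2, 3}) +
      9 * c Finset.univ = 0 := by
  intro c
  simp only [c, confCoeff_sub_sqfreeExp]
  have h9 : ∀ F : MvPolynomial (Fin 4) ℤ, 9 * coeff n F = coeff n (C 9 * F) := fun F => by
    rw [coeff_C_mul]
  rw [h9]
  simp only [← coeff_add]
  -- With the variables outside the support of `n` set to zero, the determinant argument applies to
  -- the rows in the support, which is nonempty since `n ≠ 0`.
  rw [← coeff_aeval_kill]
  convert coeff_zero n
  simp only [map_add, map_mul, aeval_C]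
  have hne : ¬ (n 0 = 0 ∧ n 1 = 0 ∧ n 2 = 0 ∧ n 3 = 0) := fun h => hn <| by
    ext i
    fin_cases i <;> simp [h]
  obtain ⟨e0, e1, e2, e3⟩ := confForm_eq
  simp only [Fin.prod_univ_four, e0, e1, e2, e3]
  rw [mul_left_comm]
  simp only [← mul_add]
  refine mul_eq_zero_of_right _ ?_
  by_cases h0 : n 0 = 0 <;> by_cases h1 : n 1 = 0 <;> by_cases h2 : n 2 = 0 <;>
    by_cases h3 : n 3 = 0 <;> simp [h0, h1, h2, h3] at hne ⊢ <;> ring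

/-- The elementary symmetric polynomial of degree two in four variables, by monomials. -/
noncomputable def esymmTwo : MvPolynomial (Fin 4) ℤ :=
  let e := fun s => MvPolynomial.monomial (sqfreeExp s) (1 : ℤ)
  e {0, 1} + e {0, 2} + e {0, 3} + e {1, 2} + e {1, 3} + e {2, 3}

/-- The polynomial `w` such that `1 - w` is the inverse of the generating series of
`confCoeff`. -/
noncomputable def confDenom : MvPolynomial (Fin 4) ℤ :=
  -(esymmTwo + 9 * MvPolynomial.monomial (sqfreeExp Finset.univ) (1 : ℤ))

/-- The generating series of `confCoeff`. -/
noncomputable def confSeries : MvPowerSeries (Fin 4) ℤ := fun n => confCoeff n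

/-- The master theorem for this matrix: $\det(I - C\,\mathrm{diag}(y)) = 1 + e_2 + 9e_4$, where 9 is
the square of the Pfaffian 3. -/
theorem confSeries_mul : confSeries * (1 - (confDenom : MvPowerSeries (Fin 4) ℤ)) = 1 := by
  have hm : ∀ (n : Fin 4 →₀ ℕ) s, MvPowerSeries.coeff n
      (confSeries * MvPowerSeries.monomial (sqfreeExp s) (1 : ℤ)) =
      if sqfreeExp s ≤ n then confCoeff (n - sqfreeExp s) else 0 := by
    intro n s
    rw [MvPowerSeries.coeff_mul_monomial, mul_one]
    rfl
  have hexp : (1 - (confDenom : MvPowerSeries (Fin 4) ℤ)) =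
      let e := fun s => MvPowerSeries.monomial (sqfreeExp s) (1 : ℤ)
      e ∅ + (e {0, 1} + e {0, 2} + e {0, 3} + e {1, 2} + e {1, 3} + e {2, 3}) +
        9 * e Finset.univ := by
    have h9 : ((9 : MvPolynomial (Fin 4) ℤ) : MvPowerSeries (Fin 4) ℤ) = 9 :=
      map_ofNat MvPolynomial.coeToMvPowerSeries.ringHom 9
    have hneg : ∀ q : MvPolynomial (Fin 4) ℤ, ((-q : MvPolynomial (Fin 4) ℤ) :
      MvPowerSeries (Fin 4) ℤ) = -q := map_neg MvPolynomial.coeToMvPowerSeries.ringHom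
    have h1 : MvPowerSeries.monomial (sqfreeExp ∅) (1 : ℤ) = 1 := rfl
    simp only [confDenom, esymmTwo, hneg, MvPolynomial.coe_add, MvPolynomial.coe_mul,
      MvPolynomial.coe_monomial, h9, h1]
    ring
  ext n
  rw [hexp]
  have h9 : ∀ f : MvPowerSeries (Fin 4) ℤ, MvPowerSeries.coeff n (9 * f) =
      9 * MvPowerSeries.coeff n f := fun f => by
    rw [show (9 : MvPowerSeries (Fin 4) ℤ) = MvPowerSeries.C 9 from
      (map_ofNat MvPowerSeries.C 9).symm, MvPowerSeries.coeff_C_mul]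
  simp only [mul_add, mul_left_comm confSeries, map_add, hm, h9]
  rcases eq_or_ne n 0 with rfl | hn
  · have hz : ∀ s : Finset (Fin 4), s.Nonempty → ¬ sqfreeExp s ≤ 0 := by
      rintro s ⟨i, hi⟩ h
      have := h i
      rw [sqfreeExp_apply, if_pos hi] at this
      simp at this
    rw [if_neg (hz {0, 1} (by simp)), if_neg (hz {0, 2} (by simp)), if_neg (hz {0, 3} (by simp)),
      if_neg (hz {1, 2} (by simp)), if_neg (hz {1, 3} (by simp)), if_neg (hz {2, 3} (by simp)),
      if_neg (hz Finset.univ (by simp))]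
    simp [sqfreeExp, confCoeff]
  · rw [confCoeff_recurrence n hn, MvPowerSeries.coeff_one, if_neg hn]

/-! ### Diagonal coefficients of the generating series. -/

/-- The exponent of the monomial `y₀ᵃ y₁ᵇ y₂ᶜ y₃ᵈ`. -/
noncomputable def expFour (a b c d : ℕ) : Fin 4 →₀ ℕ := Finsupp.equivFunOnFinite.symm ![a, b, c, d]

theorem expFour_add (a b c d a' b' c' d' : ℕ) :
    expFour a b c d + expFour a' b' c' d' = expFour (a + a') (b + b') (c + c') (d + d') := by
  ext i; fin_cases i <;> rfl

theorem nsmul_expFour (n a b c d : ℕ) :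
    n • expFour a b c d = expFour (n * a) (n * b) (n * c) (n * d) := by
  ext i; fin_cases i <;> rfl

theorem expFour_inj {a b c d a' b' c' d' : ℕ} :
    expFour a b c d = expFour a' b' c' d' ↔ a = a' ∧ b = b' ∧ c = c' ∧ d = d' := by
  refine ⟨fun h => ⟨?_, ?_, ?_, ?_⟩, ?_⟩
  · exact DFunLike.congr_fun h 0
  · exact DFunLike.congr_fun h 1
  · exact DFunLike.congr_fun h 2
  · exact DFunLike.congr_fun h 3
  · rintro ⟨rfl, rfl, rfl, rfl⟩; rfl

theorem expFour_le {a b c d a' b' c' d' : ℕ} :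
    expFour a b c d ≤ expFour a' b' c' d' ↔ a ≤ a' ∧ b ≤ b' ∧ c ≤ c' ∧ d ≤ d' := by
  refine ⟨fun h => ⟨h 0, h 1, h 2, h 3⟩, ?_⟩
  rintro ⟨h0, h1, h2, h3⟩ i
  fin_cases i <;> assumption

theorem expFour_sub (a b c d a' b' c' d' : ℕ) :
    expFour a b c d - expFour a' b' c' d' = expFour (a - a') (b - b') (c - c') (d - d') := by
  ext i; fin_cases i <;> rfl

theorem sqfreeExp_univ : sqfreeExp Finset.univ = expFour 1 1 1 1 := by
  ext i; rw [sqfreeExp_apply]; fin_cases i <;> rfl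

open MvPolynomial in
theorem coeff_pair_pow_mul_pair_pow (c p q r s : ℕ) :
    coeff (expFour p q r s) (((monomial (expFour 1 0 0 0) 1 + monomial (expFour 0 1 0 0) 1) *
      (monomial (expFour 0 0 1 0) 1 + monomial (expFour 0 0 0 1) 1) :
        MvPolynomial (Fin 4) ℤ) ^ c) =
      if p + q = c ∧ r + s = c then (c.choose p * c.choose r : ℤ) else 0 := by
  have key : ∀ x y : ℕ × ℕ, coeff (expFour p q r s)
      ((c.choose x.1 • (monomial (x.1 • expFour 1 0 0 0) 1 * monomial (x.2 • expFour 0 1 0 0) 1) :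
        MvPolynomial (Fin 4) ℤ) *
      (c.choose y.1 • (monomial (y.1 • expFour 0 0 1 0) 1 *
        monomial (y.2 • expFour 0 0 0 1) 1))) =
      if x = (p, q) ∧ y = (r, s) then (c.choose p * c.choose r : ℤ) else 0 := by
    rintro ⟨x1, x2⟩ ⟨y1, y2⟩
    simp only [monomial_mul, nsmul_expFour, expFour_add, smul_mul_smul_comm, coeff_smul,
      coeff_monomial, expFour_inj, Prod.mk.injEq, mul_one, mul_zero, add_zero, zero_add]
    by_cases h : (x1 = p ∧ x2 = q) ∧ y1 = r ∧ y2 = s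
    · obtain ⟨⟨rfl, rfl⟩, rfl, rfl⟩ := h
      simp
    · rw [if_neg h, if_neg (by tauto), smul_zero]
  rw [mul_pow, (Commute.all _ _).add_pow', (Commute.all _ _).add_pow']
  simp only [monomial_pow, one_pow]
  rw [Finset.sum_mul_sum]
  simp only [coeff_sum, key]
  split_ifs with h
  · rw [Finset.sum_eq_single (p, q), Finset.sum_eq_single (r, s)]
    · simp
    · intro y _ hy; simp [hy]
    · intro hy; exact absurd (Finset.HasAntidiagonal.mem_antidiagonal.2 h.2) hy
    · intro x _ hx; simp [hx]
    · intro hx; exact absurd (Finset.HasAntidiagonal.mem_antidiagonal.2 h.1) hx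
  · refine Finset.sum_eq_zero fun x hx => Finset.sum_eq_zero fun y hy => if_neg ?_
    rintro ⟨rfl, rfl⟩
    exact h ⟨Finset.HasAntidiagonal.mem_antidiagonal.1 hx, Finset.HasAntidiagonal.mem_antidiagonal.1 hy⟩

-- Pairing the variables as $\{y_0,y_1\}$, $\{y_2,y_3\}$ makes powers of $e_2$ accessible to the
-- binomial theorem.
open MvPolynomial in
theorem esymmTwo_eq :
    esymmTwo = (monomial (expFour 1 1 0 0) 1 + monomial (expFour 0 0 1 1) 1) +
      (monomial (expFour 1 0 0 0) 1 + monomial (expFour 0 1 0 0) 1) *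
      (monomial (expFour 0 0 1 0) 1 + monomial (expFour 0 0 0 1) 1) := by
  have h : ∀ s, sqfreeExp s = expFour (if 0 ∈ s then 1 else 0) (if 1 ∈ s then 1 else 0)
      (if 2 ∈ s then 1 else 0) (if 3 ∈ s then 1 else 0) := by
    intro s
    ext i
    rw [sqfreeExp_apply]
    fin_cases i <;> rfl
  simp only [esymmTwo, h, add_mul, mul_add, monomial_mul, expFour_add]
  simp
  ring

theorem choose_mul_choose_mul_centralBinom (N a : ℕ) (h : a ≤ N) :
    (2 * N).choose (2 * a) * (2 * a).choose a * (2 * (N - a)).choose (N - a) =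
      (2 * N).choose N * N.choose a ^ 2 := by
  obtain ⟨d, rfl⟩ := Nat.exists_eq_add_of_le h
  rw [Nat.add_sub_cancel_left]
  have h1 := Nat.choose_mul_factorial_mul_factorial (show 2 * a ≤ 2 * (a + d) by omega)
  have h2 := Nat.choose_mul_factorial_mul_factorial (show a ≤ 2 * a by omega)
  have h3 := Nat.choose_mul_factorial_mul_factorial (show d ≤ 2 * d by omega)
  have h4 := Nat.choose_mul_factorial_mul_factorial (show a + d ≤ 2 * (a + d) by omega)
  have h5 := Nat.choose_mul_factorial_mul_factorial (show a ≤ a + d by omega)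
  rw [show 2 * (a + d) - 2 * a = 2 * d by omega] at h1
  rw [show 2 * a - a = a by omega] at h2
  rw [show 2 * d - d = d by omega] at h3
  rw [show 2 * (a + d) - (a + d) = a + d by omega] at h4
  rw [Nat.add_sub_cancel_left] at h5
  have e1 : (2 * (a + d)).choose (2 * a) * (2 * a).choose a * (2 * d).choose d *
      (a ! * a ! * d ! * d !) = (2 * (a + d))! := by
    rw [← h1, ← h2, ← h3]; ring
  have e2 : (2 * (a + d)).choose (a + d) * (a + d).choose a ^ 2 *
      (a ! * a ! * d ! * d !) = (2 * (a + d))! := by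
    calc _ = (2 * (a + d)).choose (a + d) * ((a + d).choose a * a ! * d !) *
          ((a + d).choose a * a ! * d !) := by ring
      _ = _ := by rw [h5, h4]
  have hpos : 0 < a ! * a ! * d ! * d ! := by positivity
  exact Nat.eq_of_mul_eq_mul_right hpos (e1.trans e2.symm)

-- On the diagonal $y_0y_1$ and $y_2y_3$ occur equally often, say $a$ times, leaving
-- $(y_0+y_1)^{2(N-a)}(y_2+y_3)^{2(N-a)}$. The resulting sum over $a$ is `zagierC N` read backwards,
-- by `choose_mul_choose_mul_centralBinom`.
open MvPolynomial in
theorem coeff_esymmTwo_pow (b N : ℕ) :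
    coeff (expFour N N N N) (esymmTwo ^ b) =
      if b = 2 * N then ((2 * N).choose N : ℤ) * zagierC N else 0 := by
  have key : ∀ i ≤ b, ∀ x ∈ Finset.HasAntidiagonal.antidiagonal i, coeff (expFour N N N N)
      ((i.choose x.1 • (monomial (x.1 • expFour 1 1 0 0) 1 * monomial (x.2 • expFour 0 0 1 1) 1) :
        MvPolynomial (Fin 4) ℤ) *
      (((monomial (expFour 1 0 0 0) 1 + monomial (expFour 0 1 0 0) 1) *
      (monomial (expFour 0 0 1 0) 1 + monomial (expFour 0 0 0 1) 1)) ^ (b - i))) =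
      if x.2 = x.1 ∧ b = 2 * N ∧ x.1 ≤ N then
        (i.choose x.1 : ℤ) * ((b - i).choose (N - x.1)) ^ 2 else 0 := by
    rintro i hi ⟨x, y⟩ hx
    rw [Finset.HasAntidiagonal.mem_antidiagonal] at hx
    dsimp only at hx ⊢
    rw [monomial_mul, nsmul_expFour, nsmul_expFour, expFour_add, smul_mul_assoc, coeff_smul,
      coeff_monomial_mul', expFour_sub, coeff_pair_pow_mul_pair_pow]
    simp only [expFour_le, mul_one, mul_zero, add_zero, zero_add, one_mul]
    by_cases h : y = x ∧ b = 2 * N ∧ x ≤ N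
    · rw [if_pos h, if_pos (by omega), if_pos (by omega), h.1]
      simp only [nsmul_eq_mul]
      ring
    · rw [if_neg h]
      split_ifs with h1 h2
      · omega
      · simp
      · simp
  rw [esymmTwo_eq, add_pow, coeff_sum]
  have hs : ∀ i ∈ Finset.range (b + 1), coeff (expFour N N N N)
      ((monomial (expFour 1 1 0 0) 1 + monomial (expFour 0 0 1 1) 1 : MvPolynomial (Fin 4) ℤ) ^ i *
      (((monomial (expFour 1 0 0 0) 1 + monomial (expFour 0 1 0 0) 1) *
      (monomial (expFour 0 0 1 0) 1 + monomial (expFour 0 0 0 1) 1)) ^ (b - i)) *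
      (b.choose i : MvPolynomial (Fin 4) ℤ)) = ∑ x ∈ Finset.HasAntidiagonal.antidiagonal i,
      if x.2 = x.1 ∧ b = 2 * N ∧ x.1 ≤ N then
        (b.choose i : ℤ) * ((i.choose x.1 : ℤ) * ((b - i).choose (N - x.1)) ^ 2) else 0 := by
    intro i hi
    rw [(Commute.all _ _).add_pow', ← C_eq_coe_nat, mul_comm _ (C _), coeff_C_mul, Finset.sum_mul,
      coeff_sum, Finset.mul_sum]
    simp only [monomial_pow, one_pow]
    refine Finset.sum_congr rfl fun x hx => ?_
    rw [key i (by simp at hi; omega) x hx]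
    split_ifs <;> simp
  rw [Finset.sum_congr rfl hs]
  split_ifs with hb
  · subst hb
    rw [Finset.sum_sigma']
    have : ((2 * N).choose N : ℤ) * zagierC N = ∑ a ∈ Finset.range (N + 1),
        ((2 * N).choose (2 * a) : ℤ) *
          (((2 * a).choose a : ℤ) * ((2 * N - 2 * a).choose (N - a) : ℤ) ^ 2) := by
      rw [zagierC, Finset.mul_sum, ← Finset.sum_range_reflect]
      refine Finset.sum_congr rfl fun a ha => ?_
      have ha' : a ≤ N := by simp at ha; omega
      rw [show N + 1 - 1 - a = N - a by omega, Nat.choose_symm ha',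
        show 2 * N - 2 * a = 2 * (N - a) by omega]
      have := choose_mul_choose_mul_centralBinom N a ha'
      zify at this
      linear_combination -((2 * (N - a)).choose (N - a) : ℤ) * this
    rw [this]
    symm
    refine Finset.sum_of_injOn (fun a => ⟨2 * a, (a, a)⟩) ?_ ?_ ?_ ?_
    · intro a _ b _ hab
      simp at hab
      omega
    · intro a ha
      simp at ha ⊢
      omega
    · rintro ⟨i, x, y⟩ hx hn
      simp only [Finset.mem_sigma, Finset.mem_range, Finset.HasAntidiagonal.mem_antidiagonal] at hx
      rw [if_neg]
      rintro ⟨h1, -, h2⟩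
      dsimp only at h1 h2
      refine hn ⟨x, by simp; omega, ?_⟩
      obtain rfl : i = 2 * x := by omega
      rw [h1]
    · intro a ha
      have ha' : a ≤ N := by simp at ha; omega
      simp [ha']
  · refine Finset.sum_eq_zero fun i _ => Finset.sum_eq_zero fun x _ => if_neg ?_
    tauto

/-- A truncated geometric series: `confDenom` has no constant term, so its power $4n+1$ cannot
contribute in total degree $4n$. -/
theorem confCoeff_diag_eq_sum (n : ℕ) :
    confCoeff (expFour n n n n) =
      ∑ m ∈ Finset.range (4 * n + 1), MvPolynomial.coeff (expFour n n n n) (confDenom ^ m) := by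
  set w : MvPowerSeries (Fin 4) ℤ := (confDenom : MvPowerSeries (Fin 4) ℤ) with hw
  have h1 : (1 - w) * ∑ m ∈ Finset.range (4 * n + 1), w ^ m = 1 - w ^ (4 * n + 1) := by
    rw [mul_neg_geom_sum]
  have h2 : confSeries = ∑ m ∈ Finset.range (4 * n + 1), w ^ m +
      confSeries * w ^ (4 * n + 1) := by
    have := congrArg (confSeries * ·) h1
    rw [← mul_assoc, hw, confSeries_mul, ← hw, one_mul] at this
    rw [this]; ring
  have h3 : MvPowerSeries.coeff (expFour n n n n) (confSeries * w ^ (4 * n + 1)) = 0 := by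
    apply MvPowerSeries.coeff_of_lt_order
    have hc : w.constantCoeff = 0 := by
      rw [hw, ← MvPowerSeries.coeff_zero_eq_constantCoeff_apply, MvPolynomial.coeff_coe]
      have hz : ∀ s : Finset (Fin 4), s.Nonempty → sqfreeExp s ≠ 0 := by
        rintro s ⟨i, hi⟩ h
        have := DFunLike.congr_fun h i
        rw [sqfreeExp_apply, if_pos hi] at this
        simp at this
      have h9 : (9 : MvPolynomial (Fin 4) ℤ) = MvPolynomial.C 9 := (map_ofNat _ 9).symm
      simp only [confDenom, esymmTwo, MvPolynomial.coeff_neg, MvPolynomial.coeff_add, h9,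
        MvPolynomial.coeff_C_mul, MvPolynomial.coeff_monomial]
      rw [if_neg (hz {0, 1} (by simp)), if_neg (hz {0, 2} (by simp)),
        if_neg (hz {0, 3} (by simp)), if_neg (hz {1, 2} (by simp)), if_neg (hz {1, 3} (by simp)),
        if_neg (hz {2, 3} (by simp)), if_neg (hz Finset.univ (by simp))]
      simp
    have h4 := MvPowerSeries.le_order_pow_of_constantCoeff_eq_zero (4 * n + 1) hc
    have h5 : (w ^ (4 * n + 1)).order ≤ (confSeries * w ^ (4 * n + 1)).order :=
      le_trans le_add_self MvPowerSeries.le_order_mul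
    have h6 : Finsupp.degree (expFour n n n n) = 4 * n := by
      rw [Finsupp.degree_eq_sum, Fin.sum_univ_four]
      simp [expFour]
      ring
    rw [h6]
    refine lt_of_lt_of_le ?_ (h4.trans h5)
    exact_mod_cast Nat.lt_succ_self _
  have h7 : confCoeff (expFour n n n n) = MvPowerSeries.coeff (expFour n n n n) confSeries := rfl
  rw [h7, h2, map_add, h3, add_zero, map_sum]
  refine Finset.sum_congr rfl fun m _ => ?_
  rw [hw, ← MvPolynomial.coe_pow, MvPolynomial.coeff_coe]

-- If $9e_4$ is chosen $j$ times, $e_2$ must be chosen $2(n-j)$ times to reach the diagonal, which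
-- forces $m = 2n - j$.
open MvPolynomial in
theorem coeff_confDenom_pow (m n : ℕ) :
    coeff (expFour n n n n) (confDenom ^ m) = ∑ j ∈ Finset.range (n + 1),
      if m = 2 * n - j then (-1) ^ m * (m.choose j : ℤ) * 9 ^ j *
        (((2 * (n - j)).choose (n - j) : ℤ) * zagierC (n - j)) else 0 := by
  have h9 : (9 : MvPolynomial (Fin 4) ℤ) = C 9 := (map_ofNat _ 9).symm
  have h0 : confDenom = C (-1) * (monomial (expFour 1 1 1 1) 9 + esymmTwo) := by
    rw [confDenom, sqfreeExp_univ, h9, C_mul_monomial, mul_one]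
    simp
    ring
  rw [h0, mul_pow, ← C_pow, coeff_C_mul, add_pow, coeff_sum, Finset.mul_sum]
  have key : ∀ j ∈ Finset.range (m + 1), (-1) ^ m * coeff (expFour n n n n)
      (monomial (expFour 1 1 1 1) 9 ^ j * esymmTwo ^ (m - j) *
        (m.choose j : MvPolynomial (Fin 4) ℤ)) = if j ≤ n then
      if m = 2 * n - j then (-1) ^ m * (m.choose j : ℤ) * 9 ^ j *
        (((2 * (n - j)).choose (n - j) : ℤ) * zagierC (n - j)) else 0 else 0 := by
    intro j hj
    rw [Finset.mem_range] at hj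
    rw [← C_eq_coe_nat, mul_comm _ (C _), coeff_C_mul, monomial_pow, nsmul_expFour, coeff_monomial_mul',
      expFour_sub, mul_one, coeff_esymmTwo_pow]
    simp only [expFour_le, and_self]
    split_ifs with h1 h2 h3 h3
    · ring
    · omega
    · omega
    · simp
    · simp
  rw [Finset.sum_congr rfl key, ← Finset.sum_filter]
  refine Finset.sum_subset (fun j hj => ?_) fun j hj hn => ?_
  · simp at hj ⊢; omega
  · simp at hj hn
    rw [Nat.choose_eq_zero_of_lt (by omega)]
    simp

theorem confCoeff_diag (n : ℕ) : confCoeff (expFour n n n n) = legendreZagierC n := by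
  rw [confCoeff_diag_eq_sum]
  simp only [coeff_confDenom_pow]
  rw [Finset.sum_comm, legendreZagierC, ← Finset.sum_range_reflect]
  refine Finset.sum_congr rfl fun N hN => ?_
  rw [Finset.mem_range] at hN
  rw [Finset.sum_ite_eq', if_pos (by simp; omega), show n - (n + 1 - 1 - N) = N by omega,
    show 2 * n - (n + 1 - 1 - N) = n + N by omega, show n + 1 - 1 - N = n - N by omega,
    ← Nat.choose_symm_of_eq_add (show n + N = 2 * N + (n - N) by omega)]
  have : (-1 : ℤ) ^ (n + N) * 9 ^ (n - N) = (-9) ^ (n - N) := by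
    obtain ⟨d, rfl⟩ := Nat.exists_eq_add_of_le (show N ≤ n by omega)
    rw [Nat.add_sub_cancel_left, show N + d + N = 2 * N + d by ring, pow_add, pow_mul,
      show (-9 : ℤ) = (-1) * 9 by norm_num, mul_pow]
    norm_num
  rw [← this]
  ring

/-- The sporadic sequence `(δ)` as a signed diagonal coefficient of a product of powers of the
linear forms of a conference matrix. -/
theorem Adelta_eq_confCoeff (n : ℕ) : Adelta n = (-1) ^ n * confCoeff (expFour n n n n) := by
  rw [confCoeff_diag, Adelta_eq_legendreZagierC]

/-! ### Products of integers prime to p and Jacobsthal-type congruences. -/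

/-- The product of the integers below `p * b` that are not divisible by `p`. -/
def coprimeFactorial (p b : ℕ) : ℤ := ∏ i ∈ Finset.range (p * b), if p ∣ i then 1 else (i : ℤ)

theorem factorial_mul_eq (p : ℕ) (hp : 0 < p) (b : ℕ) :
    ((p * b)! : ℤ) = p ^ b * b ! * coprimeFactorial p b := by
  induction b with
  | zero => simp [coprimeFactorial]
  | succ b ih =>
    obtain ⟨q, rfl⟩ : ∃ q, p = q + 1 := ⟨p - 1, by omega⟩
    have h1 : (((q + 1) * (b + 1))! : ℤ) = ((q + 1) * b)! *
        ∏ x ∈ Finset.range (q + 1), (((q + 1) * b + x + 1 : ℕ) : ℤ) := by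
      rw [← Finset.prod_range_add_one_eq_factorial, ← Finset.prod_range_add_one_eq_factorial,
        Nat.mul_succ, Finset.prod_range_add]
      push_cast
      rfl
    have h2 : coprimeFactorial (q + 1) (b + 1) = coprimeFactorial (q + 1) b *
        ∏ x ∈ Finset.range q, (((q + 1) * b + x + 1 : ℕ) : ℤ) := by
      rw [coprimeFactorial, Nat.mul_succ, Finset.prod_range_add, Finset.prod_range_succ' _ q,
        if_pos (by simp), mul_one]
      refine congrArg₂ _ rfl (Finset.prod_congr rfl fun x hx => ?_)
      rw [if_neg, add_assoc]
      rw [Nat.dvd_add_right (dvd_mul_right _ _)]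
      exact Nat.not_dvd_of_pos_of_lt (by omega) (by simp at hx; omega)
    rw [h1, h2, ih, Finset.prod_range_succ, Nat.factorial_succ]
    push_cast
    ring

theorem not_dvd_coprimeFactorial (p : ℕ) (hp : p.Prime) (b : ℕ) :
    ¬ (p : ℤ) ∣ coprimeFactorial p b := by
  rw [coprimeFactorial, (Nat.prime_iff_prime_int.1 hp).dvd_finsetProd_iff]
  rintro ⟨i, -, hi⟩
  split_ifs at hi with h
  · exact hp.one_lt.ne' (by exact_mod_cast Int.eq_one_of_dvd_one (by positivity) hi)
  · exact h (by exact_mod_cast hi)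

theorem sum_range_natCast_zmod {A : Type*} [AddCommMonoid A] (M b : ℕ) [NeZero M]
    (f : ZMod M → A) :
    ∑ x ∈ Finset.range (M * b), f (x : ZMod M) = b • ∑ y, f y := by
  induction b with
  | zero => simp
  | succ b ih =>
    rw [Nat.mul_succ, Finset.sum_range_add, ih, succ_nsmul]
    congr 1
    refine Finset.sum_bij' (fun x _ => (x : ZMod M)) (fun y _ => y.val) ?_ ?_ ?_ ?_ ?_
    · simp
    · intro y _; simpa using ZMod.val_lt y
    · intro x hx; exact ZMod.val_cast_of_lt (by simpa using hx)
    · intro y _; simp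
    · intro x _; simp

theorem isUnit_natCast_zmod_prime_pow (p k : ℕ) (hp : p.Prime) (x : ℕ) (hx : ¬ p ∣ x) :
    IsUnit (x : ZMod (p ^ k)) := by
  rw [ZMod.isUnit_iff_coprime]
  exact Nat.Coprime.pow_right _ ((Nat.Prime.coprime_iff_not_dvd hp).2 hx).symm

/-- Non-units contribute 0. The substitution $y \mapsto 2y$ gives $S = S/4$, so $3S = 0$, and 2 and
3 are units because $p \ge 5$. -/
theorem sum_inverse_sq_zmod (p k : ℕ) (hp : p.Prime) (hp5 : 5 ≤ p) [NeZero (p ^ k)] :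
    ∑ y : ZMod (p ^ k), Ring.inverse y ^ 2 = 0 := by
  have h2 : IsUnit ((2 : ℕ) : ZMod (p ^ k)) := isUnit_natCast_zmod_prime_pow p k hp 2
    fun h => by have := Nat.le_of_dvd (by norm_num) h; omega
  have h3 : IsUnit ((3 : ℕ) : ZMod (p ^ k)) := isUnit_natCast_zmod_prime_pow p k hp 3
    fun h => by have := Nat.le_of_dvd (by norm_num) h; omega
  push_cast at h2 h3
  set S := ∑ y : ZMod (p ^ k), Ring.inverse y ^ 2 with hS
  have h : S = Ring.inverse 2 ^ 2 * S := by
    rw [hS, Finset.mul_sum]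
    rw [← Equiv.sum_comp (Units.mulLeft h2.unit) (fun y => Ring.inverse y ^ 2)]
    refine Finset.sum_congr rfl fun y _ => ?_
    rw [← mul_pow]
    congr 1
    rw [Units.mulLeft_apply, IsUnit.unit_spec, Ring.mul_inverse_rev, mul_comm]
  have h4 : (2 : ZMod (p ^ k)) * Ring.inverse 2 = 1 := Ring.mul_inverse_cancel _ h2
  have h5 : 3 * S = 0 := by
    linear_combination 4 * h + (2 * Ring.inverse 2 + 1) * S * h4
  exact h3.mul_right_eq_zero.1 h5

theorem prod_add_const {ι R : Type*} [CommRing R] [DecidableEq ι] (s : Finset ι) (w : ι → R)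
    (X : R) : ∃ c, ∏ i ∈ s, (w i + X) =
      ∏ i ∈ s, w i + X * ∑ i ∈ s, ∏ j ∈ s.erase i, w j + X ^ 2 * c := by
  induction s using Finset.induction_on with
  | empty => exact ⟨0, by simp⟩
  | insert a s ha ih =>
    obtain ⟨c, hc⟩ := ih
    refine ⟨∑ i ∈ s, ∏ j ∈ s.erase i, w j + c * (w a + X), ?_⟩
    have h1 : ∑ i ∈ s, ∏ j ∈ (insert a s).erase i, w j =
        w a * ∑ i ∈ s, ∏ j ∈ s.erase i, w j := by
      rw [Finset.mul_sum]
      refine Finset.sum_congr rfl fun i hi => ?_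
      have hia : a ≠ i := by rintro rfl; exact ha hi
      rw [Finset.erase_insert_of_ne hia, Finset.prod_insert (by simp [ha])]
    rw [Finset.prod_insert ha, Finset.prod_insert ha, Finset.sum_insert ha,
      Finset.erase_insert ha, h1, hc]
    ring

theorem sum_prod_erase_eq {ι R : Type*} [CommRing R] [DecidableEq ι] (s : Finset ι) (w : ι → R)
    (hw : ∀ i ∈ s, IsUnit (w i)) :
    ∑ i ∈ s, ∏ j ∈ s.erase i, w j = (∏ i ∈ s, w i) * ∑ i ∈ s, Ring.inverse (w i) := by
  rw [Finset.mul_sum]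
  refine Finset.sum_congr rfl fun i hi => ?_
  rw [← Finset.mul_prod_erase s w hi, mul_comm (w i), mul_assoc,
    Ring.mul_inverse_cancel _ (hw i hi), mul_one]

/-- The first symmetric function in the numbers `1 / (x (p b - x))` vanishes to high order. -/
theorem dvd_sum_prod_erase (p : ℕ) (hp : p.Prime) (hp5 : 5 ≤ p) (b β : ℕ) (hb : p ^ β ∣ b) :
    (p : ℤ) ^ (1 + β) ∣ ∑ i ∈ (Finset.range (p * b)).filter (¬ p ∣ ·),
      ∏ j ∈ ((Finset.range (p * b)).filter (¬ p ∣ ·)).erase i, ((j : ℤ) * (p * b - j)) := by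
  set U := (Finset.range (p * b)).filter (¬ p ∣ ·) with hU
  have : NeZero (p ^ (1 + β)) := ⟨(pow_pos hp.pos _).ne'⟩
  have hpb : ((p : ZMod (p ^ (1 + β))) * b) = 0 := by
    obtain ⟨c, rfl⟩ := hb
    have := ZMod.natCast_self (p ^ (1 + β))
    push_cast at this ⊢
    rw [← mul_assoc, ← _root_.pow_succ', add_comm β 1, this, zero_mul]
  have hu : ∀ i ∈ U, IsUnit (i : ZMod (p ^ (1 + β))) := fun i hi =>
    isUnit_natCast_zmod_prime_pow p _ hp i (Finset.mem_filter.1 hi).2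
  have := (ZMod.intCast_zmod_eq_zero_iff_dvd (∑ i ∈ U, ∏ j ∈ U.erase i, ((j : ℤ) * (p * b - j)))
    (p ^ (1 + β))).1 ?_
  · exact_mod_cast this
  push_cast
  -- Modulo $p^{1+\beta}$ the factor $j(pb-j)$ is $-j^2$, which leads to the sum of inverse squares.
  simp only [hpb, zero_sub]
  rw [sum_prod_erase_eq U (fun j => (j : ZMod (p ^ (1 + β))) * -j)
    fun i hi => (hu i hi).mul (hu i hi).neg]
  refine mul_eq_zero_of_right _ ?_
  have h1 : ∀ i ∈ U, Ring.inverse ((i : ZMod (p ^ (1 + β))) * -i) =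
      - Ring.inverse (i : ZMod (p ^ (1 + β))) ^ 2 := by
    intro i hi
    have hi' := Ring.mul_inverse_cancel _ (hu i hi)
    have hi2 := Ring.mul_inverse_cancel _ ((hu i hi).mul (hu i hi).neg)
    set x := (i : ZMod (p ^ (1 + β)))
    linear_combination (-Ring.inverse x ^ 2) * hi2 -
      (Ring.inverse (x * -x) * (x * Ring.inverse x + 1)) * hi'
  rw [Finset.sum_congr rfl h1, Finset.sum_neg_distrib, neg_eq_zero]
  have h2 : ∑ i ∈ U, Ring.inverse (i : ZMod (p ^ (1 + β))) ^ 2 =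
      ∑ i ∈ Finset.range (p * b), Ring.inverse (i : ZMod (p ^ (1 + β))) ^ 2 := by
    rw [hU, Finset.sum_filter]
    refine Finset.sum_congr rfl fun i _ => ?_
    by_cases h : p ∣ i
    swap
    · rw [if_pos h]
    · rw [if_neg (not_not.2 h), Ring.inverse_non_unit, zero_pow two_ne_zero]
      rw [ZMod.isUnit_iff_coprime]
      intro hc
      have h1 : p ∣ p ^ (1 + β) := dvd_pow_self p (by omega)
      exact hp.one_lt.ne' (Nat.dvd_one.1 (hc ▸ Nat.dvd_gcd h h1))
  rw [h2]
  obtain ⟨c, rfl⟩ := hb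
  rw [show p * (p ^ β * c) = p ^ (1 + β) * c by rw [pow_add]; ring,
    sum_range_natCast_zmod (p ^ (1 + β)) c (fun y => Ring.inverse y ^ 2),
    sum_inverse_sq_zmod p _ hp hp5, smul_zero]

/-- Write $\Phi(a+b) = \Phi(a)Q$ with $Q = \prod(x+pa)$. Pairing $x$ with $pb-x$ gives $Q^2 =
\prod(x(pb-x)+X)$ with $X = p^2a(a+b)$, while $\Phi(b)^2$ is the same product at $X=0$. The linear
term in $X$ has the required valuation by `dvd_sum_prod_erase`, the higher terms because $\beta \le
\alpha$. Finally $Q+\Phi(b) \equiv 2\Phi(b)$ is prime to $p$, so the power divides $Q-\Phi(b)$. -/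
theorem coprimeFactorial_add_of_le (p : ℕ) (hp : p.Prime) (hp5 : 5 ≤ p) {a b α β γ : ℕ}
    (ha : p ^ α ∣ a) (hb : p ^ β ∣ b) (hab : p ^ γ ∣ a + b) (hle : β ≤ α) :
    (p : ℤ) ^ (3 + α + β + γ) ∣
      coprimeFactorial p (a + b) - coprimeFactorial p a * coprimeFactorial p b := by
  set U := (Finset.range (p * b)).filter (¬ p ∣ ·) with hU
  have hΦ : coprimeFactorial p b = ∏ x ∈ U, (x : ℤ) := by
    rw [coprimeFactorial, hU, Finset.prod_filter]
    exact Finset.prod_congr rfl fun x _ => by split_ifs <;> simp_all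
  set Q := ∏ x ∈ U, ((x : ℤ) + p * a) with hQ
  have hadd : coprimeFactorial p (a + b) = coprimeFactorial p a * Q := by
    rw [coprimeFactorial, mul_add, Finset.prod_range_add, hQ, hU, Finset.prod_filter,
      coprimeFactorial]
    refine congrArg₂ _ rfl (Finset.prod_congr rfl fun x _ => ?_)
    have hx : p ∣ p * a + x ↔ p ∣ x := Nat.dvd_add_right (dvd_mul_right _ _)
    by_cases h : p ∣ x
    · rw [if_pos (hx.2 h), if_neg (not_not.2 h)]
    · rw [if_neg (mt hx.1 h), if_pos h]
      push_cast
      ring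
  rw [hadd, ← mul_sub]
  refine Dvd.dvd.mul_left ?_ _
  have hrefl : ∀ f : ℤ → ℤ, ∏ x ∈ U, f (x : ℤ) = ∏ x ∈ U, f ((p : ℤ) * b - x) := by
    intro f
    have hx0 : ∀ x ∈ U, 0 < x ∧ x < p * b ∧ ¬ p ∣ x := by
      intro x hx
      simp only [hU, Finset.mem_filter, Finset.mem_range] at hx
      exact ⟨Nat.pos_of_ne_zero (by rintro rfl; simp at hx), hx.1, hx.2⟩
    have hmem : ∀ x ∈ U, p * b - x ∈ U := by
      intro x hx
      obtain ⟨h1, h2, h3⟩ := hx0 x hx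
      simp only [hU, Finset.mem_filter, Finset.mem_range]
      refine ⟨by omega, fun h => h3 ?_⟩
      have := Nat.dvd_sub (dvd_mul_right p b) h
      rwa [show p * b - (p * b - x) = x by omega] at this
    refine Finset.prod_bij' (fun x _ => p * b - x) (fun x _ => p * b - x) hmem hmem ?_ ?_ ?_
    · intro x hx; have := hx0 x hx; omega
    · intro x hx; have := hx0 x hx; omega
    · intro x hx
      have := hx0 x hx
      congr 1
      rw [Nat.cast_sub (by omega)]
      push_cast; ring
  have hQ2 : Q ^ 2 = ∏ x ∈ U, ((x : ℤ) * (p * b - x) + p ^ 2 * a * (a + b)) := by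
    rw [sq]
    nth_rewrite 2 [hQ]
    rw [hrefl (fun y => y + p * a), hQ, ← Finset.prod_mul_distrib]
    exact Finset.prod_congr rfl fun x _ => by ring
  have hΦ2 : coprimeFactorial p b ^ 2 = ∏ x ∈ U, ((x : ℤ) * (p * b - x)) := by
    rw [sq, hΦ]
    nth_rewrite 2 [hrefl (fun y => y)]
    rw [← Finset.prod_mul_distrib]
  obtain ⟨c, hc⟩ := prod_add_const U (fun x : ℕ => (x : ℤ) * (p * b - x))
    ((p : ℤ) ^ 2 * a * (a + b))
  have hS := dvd_sum_prod_erase p hp hp5 b β hb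
  rw [← hU] at hS
  have hX : (p : ℤ) ^ (2 + α + γ) ∣ (p : ℤ) ^ 2 * a * (a + b) := by
    rw [pow_add, pow_add]
    exact mul_dvd_mul (mul_dvd_mul_left _ (by exact_mod_cast ha)) (by exact_mod_cast hab)
  have hprod : (p : ℤ) ^ (3 + α + β + γ) ∣
      (Q + coprimeFactorial p b) * (Q - coprimeFactorial p b) := by
    rw [← _root_.sq_sub_sq, hQ2, hΦ2, hc]
    rw [show ∀ x y z : ℤ, x + y + z - x = y + z by intros; ring]
    refine dvd_add ?_ (Dvd.dvd.mul_right ?_ _)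
    · refine (pow_dvd_pow _ ?_).trans ((pow_add (p : ℤ) (2 + α + γ) (1 + β)).dvd.trans
        (mul_dvd_mul hX hS))
      omega
    · refine (pow_dvd_pow _ ?_).trans ((pow_mul (p : ℤ) (2 + α + γ) 2).dvd.trans
        (pow_dvd_pow_of_dvd hX 2))
      omega
  have hpI := Nat.prime_iff_prime_int.1 hp
  have hmod : (p : ℤ) ∣ Q - coprimeFactorial p b := by
    rw [hQ, hΦ, ← Int.modEq_iff_dvd]
    refine Int.ModEq.symm ?_
    refine Int.ModEq.prod fun x _ => ?_
    rw [Int.modEq_iff_dvd]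
    exact ⟨-a, by ring⟩
  have hnd : ¬ (p : ℤ) ∣ Q + coprimeFactorial p b := by
    intro h
    have h2 : (p : ℤ) ∣ 2 * coprimeFactorial p b := by
      have := dvd_sub h hmod
      rwa [show Q + coprimeFactorial p b - (Q - coprimeFactorial p b) =
        2 * coprimeFactorial p b by ring] at this
    rcases hpI.dvd_or_dvd h2 with h3 | h3
    · have := Int.le_of_dvd (by norm_num) h3
      omega
    · exact not_dvd_coprimeFactorial p hp b h3
  exact hpI.pow_dvd_of_dvd_mul_left _ hnd hprod

theorem coprimeFactorial_add (p : ℕ) (hp : p.Prime) (hp5 : 5 ≤ p) {a b α β γ : ℕ}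
    (ha : p ^ α ∣ a) (hb : p ^ β ∣ b) (hab : p ^ γ ∣ a + b) :
    (p : ℤ) ^ (3 + α + β + γ) ∣
      coprimeFactorial p (a + b) - coprimeFactorial p a * coprimeFactorial p b := by
  rcases le_total β α with h | h
  · exact coprimeFactorial_add_of_le p hp hp5 ha hb hab h
  · rw [add_comm a b] at hab ⊢
    rw [mul_comm, show 3 + α + β + γ = 3 + β + α + γ by ring]
    exact coprimeFactorial_add_of_le p hp hp5 hb ha hab h

/-- Since $p^\gamma$ divides both $c$ and the total, it divides $a+b$. The two-term congruence is
applied to $(a+b)+c$ and to $a+b$. -/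
theorem coprimeFactorial_add_add_of_le (p : ℕ) (hp : p.Prime) (hp5 : 5 ≤ p) {a b c α β γ s : ℕ}
    (ha : p ^ α ∣ a) (hb : p ^ β ∣ b) (hc : p ^ γ ∣ c) (hs : p ^ s ∣ a + b + c)
    (hβ : β ≤ s) (hγ : γ ≤ s) (hle : α ≤ γ) :
    (p : ℤ) ^ (3 + α + β + γ) ∣ coprimeFactorial p (a + b + c) -
      coprimeFactorial p a * coprimeFactorial p b * coprimeFactorial p c := by
  have hab : p ^ γ ∣ a + b := (Nat.dvd_add_left hc).1 ((pow_dvd_pow p hγ).trans hs)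
  have h1 := coprimeFactorial_add p hp hp5 hab hc hs
  have h2 := coprimeFactorial_add p hp hp5 ha hb hab
  have h3 := (pow_dvd_pow (p : ℤ) (show 3 + α + β + γ ≤ 3 + γ + γ + s by omega)).trans h1
  have := dvd_add h3 (h2.mul_right (coprimeFactorial p c))
  rwa [sub_mul, sub_add_sub_cancel] at this

/-- A three-term Jacobsthal-type congruence. -/
theorem coprimeFactorial_add_add (p : ℕ) (hp : p.Prime) (hp5 : 5 ≤ p) {a b c α β γ s : ℕ}
    (ha : p ^ α ∣ a) (hb : p ^ β ∣ b) (hc : p ^ γ ∣ c) (hs : p ^ s ∣ a + b + c)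
    (hα : α ≤ s) (hβ : β ≤ s) (hγ : γ ≤ s) :
    (p : ℤ) ^ (3 + α + β + γ) ∣ coprimeFactorial p (a + b + c) -
      coprimeFactorial p a * coprimeFactorial p b * coprimeFactorial p c := by
  rcases le_total α γ with h | h
  · exact coprimeFactorial_add_add_of_le p hp hp5 ha hb hc hs hβ hγ h
  · have := coprimeFactorial_add_add_of_le p hp hp5 hc hb ha
      (by rwa [show c + b + a = a + b + c by ring]) hβ hα h
    rw [show c + b + a = a + b + c by ring, show 3 + γ + β + α = 3 + α + β + γ by ring] at this
    convert this using 1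
    ring

/-! ### Binomial coefficients modulo prime powers and alternating sums. -/

theorem choose_succ_mul_int (N k : ℕ) :
    (N.choose (k + 1) : ℤ) * (k + 1) = N.choose k * (N - k) := by
  rcases le_or_gt k N with h | h
  · have := Nat.choose_succ_right_eq N k
    zify [h] at this
    exact this
  · rw [Nat.choose_eq_zero_of_lt h, Nat.choose_eq_zero_of_lt (by omega)]
    simp

/-- In $\binom{pU-1}{c} = \prod_{i\le c}(pU-i)/i$ the factors with $p \mid i$ form
$\binom{U-1}{\lfloor c/p\rfloor}$; the others are kept, with denominators cleared. -/
theorem choose_pred_mul_prod (p : ℕ) (hp : 0 < p) (U c : ℕ) (hU : 0 < U) :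
    ((p * U - 1).choose c : ℤ) * ∏ i ∈ Finset.range c, (if p ∣ i + 1 then 1 else (i + 1 : ℤ)) =
      (U - 1).choose (c / p) *
        ∏ i ∈ Finset.range c, (if p ∣ i + 1 then 1 else ((p * U : ℤ) - (i + 1))) := by
  have hpU : 0 < p * U := Nat.mul_pos hp hU
  induction c with
  | zero => simp
  | succ c ih =>
    have hstep := choose_succ_mul_int (p * U - 1) c
    rw [Nat.cast_sub (by omega)] at hstep
    push_cast at hstep
    rw [Finset.prod_range_succ, Finset.prod_range_succ]
    by_cases h : p ∣ c + 1
    · obtain ⟨e, he⟩ := h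
      obtain ⟨f, rfl⟩ : ∃ f, e = f + 1 :=
        Nat.exists_eq_succ_of_ne_zero (by rintro rfl; simp at he)
      have h1 : (c + 1) / p = f + 1 := by rw [he, Nat.mul_div_cancel_left _ hp]
      have h2 : c / p = f := by
        rw [show c = p * f + (p - 1) by rw [Nat.mul_succ] at he; omega,
          Nat.mul_add_div hp, Nat.div_eq_of_lt (by omega), add_zero]
      rw [h2] at ih
      rw [if_pos ⟨_, he⟩, if_pos ⟨_, he⟩, mul_one, mul_one, h1]
      have hstep2 := choose_succ_mul_int (U - 1) f
      rw [Nat.cast_sub (by omega)] at hstep2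
      push_cast at hstep2
      have he' : (c : ℤ) + 1 = p * (f + 1) := by exact_mod_cast he
      have hne : (p : ℤ) * (f + 1) ≠ 0 := by positivity
      apply mul_right_cancel₀ hne
      have hc : (c : ℤ) = p * (f + 1) - 1 := by linarith
      rw [he', hc] at hstep
      linear_combination (∏ i ∈ Finset.range c, (if p ∣ i + 1 then 1 else (i + 1 : ℤ))) * hstep +
        (p * (U - f - 1) : ℤ) * ih - (p : ℤ) * (∏ i ∈ Finset.range c,
          (if p ∣ i + 1 then 1 else ((p * U : ℤ) - (i + 1)))) * hstep2
    · rw [if_neg h, if_neg h, Nat.succ_div_of_not_dvd h]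
      linear_combination (∏ i ∈ Finset.range c, (if p ∣ i + 1 then 1 else (i + 1 : ℤ))) * hstep +
        ((p * U : ℤ) - (c + 1)) * ih

/-- The binomial coefficients `C(u - 1, c)` with `u` divisible by a high power of `p` depend,
up to sign, only on `c / p`. -/
theorem dvd_choose_pred_sub (p : ℕ) (hp : p.Prime) {U c t : ℕ} (hU : 0 < U)
    (ht : p ^ t ∣ p * U) :
    (p : ℤ) ^ t ∣ ((p * U - 1).choose c : ℤ) - (-1) ^ (c + c / p) * (U - 1).choose (c / p) := by
  set E : ℤ := ∏ i ∈ Finset.range c, (if p ∣ i + 1 then 1 else (i + 1 : ℤ)) with hE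
  -- The number of $i \le c$ prime to $p$ is $c - \lfloor c/p\rfloor$, of the same parity as $c +
  -- \lfloor c/p\rfloor$.
  have hsign : ∏ i ∈ Finset.range c, (if p ∣ i + 1 then 1 else (-(i + 1) : ℤ)) =
      (-1) ^ (c + c / p) * E := by
    rw [hE]
    clear hE E
    induction c with
    | zero => simp
    | succ c ih =>
      rw [Finset.prod_range_succ, Finset.prod_range_succ, ih]
      by_cases h : p ∣ c + 1
      · rw [if_pos h, if_pos h, Nat.succ_div_of_dvd h,
          show c + 1 + (c / p + 1) = c + c / p + 2 by ring, _root_.pow_add _ _ 2]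
        norm_num
      · rw [if_neg h, if_neg h, Nat.succ_div_of_not_dvd h,
          show c + 1 + c / p = c + c / p + 1 by ring, _root_.pow_succ]
        ring
  have hF : (p : ℤ) ^ t ∣ ∏ i ∈ Finset.range c, (if p ∣ i + 1 then 1 else ((p * U : ℤ) - (i + 1))) -
      (-1) ^ (c + c / p) * E := by
    rw [← hsign, ← Int.modEq_iff_dvd]
    refine Int.ModEq.prod fun i _ => ?_
    split_ifs
    · rfl
    · rw [Int.modEq_iff_dvd, show (p * U : ℤ) - (i + 1) - -(i + 1) = p * U by ring]
      exact_mod_cast ht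
  have hpI := Nat.prime_iff_prime_int.1 hp
  have hE0 : ¬ (p : ℤ) ∣ E := by
    rw [hE, hpI.dvd_finsetProd_iff]
    rintro ⟨i, -, hi⟩
    split_ifs at hi with h
    · exact hp.one_lt.ne' (by exact_mod_cast Int.eq_one_of_dvd_one (by positivity) hi)
    · exact h (by exact_mod_cast hi)
  refine hpI.pow_dvd_of_dvd_mul_left _ hE0 ?_
  have := choose_pred_mul_prod p hp.pos U c hU
  rw [← hE] at this
  have h2 := hF.mul_left ((U - 1).choose (c / p) : ℤ)
  rw [mul_sub, ← this] at h2
  convert h2 using 1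
  ring

/-- The signs from `dvd_choose_pred_sub` for the two factors cancel: their exponents add up to
$(p+1)V-2$, which is even for odd $p$. -/
theorem dvd_choose_pred_mul_sub (p : ℕ) (hp : p.Prime) (hodd : Odd p) {U X V c t : ℕ} (hU : 0 < U)
    (hX : 0 < X) (hc : c < p * V) (htU : p ^ t ∣ p * U) (htX : p ^ t ∣ p * X) :
    (p : ℤ) ^ t ∣ ((p * U - 1).choose c : ℤ) * (p * X - 1).choose (p * V - 1 - c) -
      (U - 1).choose (c / p) * (X - 1).choose (V - 1 - c / p) := by
  have h1 := dvd_choose_pred_sub p hp (c := c) hU htU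
  have h2 := dvd_choose_pred_sub p hp (c := p * V - 1 - c) hX htX
  have hcV : c / p < V := Nat.div_lt_of_lt_mul hc
  have hdiv : (p * V - 1 - c) / p = V - 1 - c / p := by
    have hm := Nat.div_add_mod c p
    have hml := Nat.mod_lt c hp.pos
    obtain ⟨d, hd⟩ : ∃ d, V = c / p + 1 + d := Nat.exists_eq_add_of_le hcV
    have hV : p * V = p * (c / p) + p + p * d := by rw [hd]; ring
    rw [show p * V - 1 - c = p * d + (p - 1 - c % p) by omega, Nat.mul_add_div hp.pos,
      Nat.div_eq_of_lt (by omega)]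
    omega
  rw [hdiv] at h2
  have hs : (-1 : ℤ) ^ (c + c / p) * (-1) ^ (p * V - 1 - c + (V - 1 - c / p)) = 1 := by
    rw [← pow_add]
    refine Even.neg_one_pow ?_
    generalize c / p = q at hcV
    have hpV : V ≤ p * V := Nat.le_mul_of_pos_left _ hp.pos
    rw [show c + q + (p * V - 1 - c + (V - 1 - q)) = p * V + V - 2 by omega]
    have : Even (p * V + V) := by
      rw [show p * V + V = (p + 1) * V by ring]
      exact hodd.add_one.mul_right V
    exact (Nat.even_sub (by omega)).2 (by simp [this])
  have h3 := dvd_add (h1.mul_right ((p * X - 1).choose (p * V - 1 - c) : ℤ))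
    (h2.mul_left ((-1) ^ (c + c / p) * ((U - 1).choose (c / p) : ℤ)))
  obtain ⟨k, hk⟩ := h3
  exact ⟨k, by linear_combination hk + ((U - 1).choose (c / p) : ℤ) *
    (X - 1).choose (V - 1 - c / p) * hs⟩

theorem sum_range_mul_eq {A : Type*} [AddCommMonoid A] (p V : ℕ) (f : ℕ → A) :
    ∑ x ∈ Finset.range (p * V), f x =
      ∑ c ∈ Finset.range V, ∑ i ∈ Finset.range p, f (p * c + i) := by
  induction V with
  | zero => simp
  | succ V ih => rw [Nat.mul_succ, Finset.sum_range_add, ih, Finset.sum_range_succ]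

theorem intCast_dvd_padicInt {p : ℕ} [Fact p.Prime] {t : ℕ} {z : ℤ} (h : (p : ℤ) ^ t ∣ z) :
    (p : ℤ_[p]) ^ t ∣ z := (PadicInt.pow_p_dvd_int_iff t z).2 h

/-- Summation by blocks against a function whose block sums are divisible by the block length. -/
theorem pow_dvd_sum_choose_mul (p : ℕ) [hp : Fact p.Prime] (hodd : Odd p) (t : ℕ) :
    ∀ (s u x v : ℕ) (h : ℕ → ℤ_[p]), 0 < u → 0 < x → p ^ t ∣ u → p ^ t ∣ x → p ^ t ∣ v →
      (∀ j ≤ t, ∀ c, (p : ℤ_[p]) ^ (s + j) ∣ ∑ i ∈ Finset.range (p ^ j), h (p ^ j * c + i)) →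
      (p : ℤ_[p]) ^ (s + t) ∣
        ∑ c ∈ Finset.range v, ((u - 1).choose c * (x - 1).choose (v - 1 - c) : ℤ_[p]) * h c := by
  induction t with
  | zero =>
    intro s u x v h _ _ _ _ _ hh
    refine Finset.dvd_sum fun c _ => Dvd.dvd.mul_left ?_ _
    simpa using hh 0 le_rfl c
  | succ t ih =>
    intro s u x v h hu hx hpu hpx hpv hh
    have hp1 : p ∣ p ^ (t + 1) := dvd_pow_self p (by omega)
    obtain ⟨U, rfl⟩ := hp1.trans hpu
    obtain ⟨X, rfl⟩ := hp1.trans hpx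
    obtain ⟨V, rfl⟩ := hp1.trans hpv
    have hU : 0 < U := Nat.pos_of_mul_pos_left hu
    have hX : 0 < X := Nat.pos_of_mul_pos_left hx
    have hred : ∀ W, p ^ (t + 1) ∣ p * W → p ^ t ∣ W := fun W hW => by
      rw [_root_.pow_succ'] at hW
      exact Nat.dvd_of_mul_dvd_mul_left hp.out.pos hW
    -- Sums of `h` over blocks of length $p$ satisfy the same hypothesis with `s + 1` in place of
    -- `s`.
    have key := ih (s + 1) U X V (fun c => ∑ i ∈ Finset.range p, h (p * c + i)) hU hX
      (hred _ hpu) (hred _ hpx) (hred _ hpv) (by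
        intro j hj c
        have := hh (j + 1) (by omega) c
        rw [_root_.pow_succ', sum_range_mul_eq] at this
        convert this using 1
        · congr 1; ring
        · refine Finset.sum_congr rfl fun i _ => Finset.sum_congr rfl fun k _ => ?_
          congr 1; ring)
    -- Replacing the weights by weights depending only on `c / p` changes each by a multiple of
    -- $p^{t+1}$, and `h c` is itself divisible by $p^s$.
    have hdiff : (p : ℤ_[p]) ^ (s + (t + 1)) ∣ ∑ c ∈ Finset.range (p * V),
        ((((p * U - 1).choose c : ℤ) * (p * X - 1).choose (p * V - 1 - c) -
          (U - 1).choose (c / p) * (X - 1).choose (V - 1 - c / p) : ℤ) : ℤ_[p]) * h c := by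
      refine Finset.dvd_sum fun c hc => ?_
      rw [add_comm s, pow_add]
      refine mul_dvd_mul (intCast_dvd_padicInt ?_) (by simpa using hh 0 (by omega) c)
      exact dvd_choose_pred_mul_sub p hp.out hodd hU hX (Finset.mem_range.1 hc) hpu hpx
    rw [show s + 1 + t = s + (t + 1) by ring] at key
    have := dvd_add hdiff key
    convert this using 1
    rw [sum_range_mul_eq, sum_range_mul_eq, ← Finset.sum_add_distrib]
    refine Finset.sum_congr rfl fun c _ => ?_
    rw [Finset.mul_sum, ← Finset.sum_add_distrib]
    refine Finset.sum_congr rfl fun i hi => ?_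
    have : (p * c + i) / p = c := by
      rw [Nat.mul_add_div hp.out.pos, Nat.div_eq_of_lt (Finset.mem_range.1 hi), add_zero]
    rw [this]
    push_cast
    ring

/-- The weight `(-1)ᵃ / a²` on integers prime to `p`. -/
noncomputable def altInvSq (p : ℕ) [Fact p.Prime] (a : ℕ) : ℤ_[p] :=
  if p ∣ a then 0 else (-1) ^ a * Ring.inverse (a : ℤ_[p]) ^ 2

theorem isUnit_intCast_padicInt {p : ℕ} [Fact p.Prime] {z : ℤ} (h : ¬ (p : ℤ) ∣ z) :
    IsUnit (z : ℤ_[p]) := by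
  rw [PadicInt.isUnit_iff]
  exact le_antisymm (PadicInt.norm_le_one _)
    (not_lt.1 fun h1 => h (PadicInt.norm_intCast_lt_one_iff.1 h1))

theorem isUnit_natCast_padicInt {p : ℕ} [hp : Fact p.Prime] {a : ℕ} (h : ¬ p ∣ a) :
    IsUnit (a : ℤ_[p]) := by
  have := isUnit_intCast_padicInt (p := p) (z := a) (by exact_mod_cast h)
  exact_mod_cast this

/-- For $b \equiv -a$ the inverse squares agree modulo $p^j$, while the signs are opposite because
$a+b$ is odd. -/
theorem pow_dvd_altInvSq_add (p : ℕ) [hp : Fact p.Prime] {a b j : ℕ} (hj : j ≠ 0)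
    (hodd : Odd (a + b)) (hd : p ^ j ∣ a + b) :
    (p : ℤ_[p]) ^ j ∣ altInvSq p a + altInvSq p b := by
  have hpd : p ∣ a + b := (dvd_pow_self p hj).trans hd
  by_cases ha : p ∣ a
  · have hb : p ∣ b := (Nat.dvd_add_right ha).1 hpd
    simp [altInvSq, ha, hb]
  · have hb : ¬ p ∣ b := fun hb => ha ((Nat.dvd_add_left hb).1 hpd)
    have hs : (-1 : ℤ_[p]) ^ b = -(-1) ^ a := by
      have h1 : (-1 : ℤ_[p]) ^ a * (-1) ^ b = -1 := by rw [← pow_add, hodd.neg_one_pow]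
      have h2 : (-1 : ℤ_[p]) ^ a * (-1) ^ a = 1 := by rw [← mul_pow]; norm_num
      linear_combination (-1 : ℤ_[p]) ^ a * h1 - (-1 : ℤ_[p]) ^ b * h2
    rw [altInvSq, altInvSq, if_neg ha, if_neg hb, hs]
    have ua := Ring.mul_inverse_cancel _ (isUnit_natCast_padicInt ha)
    have ub := Ring.mul_inverse_cancel _ (isUnit_natCast_padicInt hb)
    have hab : (p : ℤ_[p]) ^ j ∣ (a + b : ℤ_[p]) := by exact_mod_cast Nat.cast_dvd_cast (α := ℤ_[p]) hd
    refine hab.trans ⟨(-1) ^ a * (b - a) * Ring.inverse (a : ℤ_[p]) ^ 2 *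
      Ring.inverse (b : ℤ_[p]) ^ 2, ?_⟩
    set A := Ring.inverse (a : ℤ_[p])
    set B := Ring.inverse (b : ℤ_[p])
    linear_combination (-1) ^ a * B ^ 2 * (a * A + 1) * ua - (-1) ^ a * A ^ 2 * (b * B + 1) * ub

/-- Reflecting the block pairs indices whose sum $p^j(2c+1)$ is odd and divisible by $p^j$. So twice
the sum is divisible by $p^j$, and 2 is a unit. -/
theorem pow_dvd_sum_altInvSq (p : ℕ) [hp : Fact p.Prime] (hodd : Odd p) (j c : ℕ) :
    (p : ℤ_[p]) ^ j ∣ ∑ i ∈ Finset.range (p ^ j), altInvSq p (p ^ j * c + i) := by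
  rcases Nat.eq_zero_or_pos j with rfl | hj
  · simp
  obtain ⟨q, hq⟩ : ∃ q, p ^ j = q + 1 :=
    Nat.exists_eq_succ_of_ne_zero (pow_pos hp.out.pos j).ne'
  have h0 : altInvSq p (p ^ j * c) = 0 :=
    if_pos ((dvd_pow_self p hj.ne').mul_right c)
  set S := ∑ i ∈ Finset.range q, altInvSq p (p ^ j * c + (i + 1)) with hS
  have h1 : ∑ i ∈ Finset.range (p ^ j), altInvSq p (p ^ j * c + i) = S := by
    rw [show Finset.range (p ^ j) = Finset.range (q + 1) by rw [hq], Finset.sum_range_succ', add_zero,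
      h0, add_zero]
  have h2 : (p : ℤ_[p]) ^ j ∣ 2 * S := by
    rw [two_mul]
    nth_rewrite 2 [hS]
    rw [← Finset.sum_range_reflect, hS, ← Finset.sum_add_distrib]
    refine Finset.dvd_sum fun i hi => ?_
    rw [Finset.mem_range] at hi
    have e : p ^ j * c + (i + 1) + (p ^ j * c + (q - 1 - i + 1)) = p ^ j * (2 * c + 1) := by
      rw [show p ^ j * (2 * c + 1) = p ^ j * c + p ^ j * c + p ^ j by ring]
      omega
    refine pow_dvd_altInvSq_add p hj.ne' ?_ ?_
    · rw [e]
      exact (hodd.pow).mul (odd_two_mul_add_one c)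
    · rw [e]
      exact dvd_mul_right _ _
  rw [h1]
  have hu : IsUnit ((2 : ℕ) : ℤ_[p]) := isUnit_natCast_padicInt fun h => by
    have h2 := (Nat.prime_dvd_prime_iff_eq hp.out Nat.prime_two).1 h
    rw [h2] at hodd
    exact absurd hodd (by decide)
  push_cast at hu
  exact (hu.dvd_mul_left).1 h2

/-- The alternating sum over indices prime to `p` that governs pairs of rows. -/
theorem pow_dvd_choose_mul_sum (p : ℕ) [hp : Fact p.Prime] (hodd : Odd p) {n r t u w v : ℕ}
    (hn : p ^ r ∣ n) (hu : p ^ t ∣ u) (hw : p ^ t ∣ w) (hv : p ^ t ∣ v)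
    (ht : t ≠ 0) :
    (p : ℤ) ^ (2 * r + t) ∣ n.choose u * n.choose w *
      ∑ a ∈ Finset.range (v + 1), if p ∣ a then 0 else
        (-1) ^ a * ((u.choose a : ℤ) * w.choose (v - a)) := by
  have hpt : p ∣ p ^ t := dvd_pow_self p ht
  rcases Nat.eq_zero_or_pos u with rfl | hu0
  · rw [Finset.sum_eq_zero, mul_zero]
    · exact dvd_zero _
    · intro a _
      split_ifs with h
      · rfl
      · rw [Nat.choose_eq_zero_of_lt (Nat.pos_of_ne_zero (n := a) (by rintro rfl; exact h (dvd_zero p)))]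
        simp
  rcases Nat.eq_zero_or_pos w with rfl | hw0
  · rw [Finset.sum_eq_zero, mul_zero]
    · exact dvd_zero _
    · intro a ha
      split_ifs with h
      · rfl
      · have : a ≠ v := by rintro rfl; exact h (hpt.trans hv)
        rw [Nat.choose_eq_zero_of_lt (n := 0) (by simp at ha; omega)]
        simp
  rw [← Int.cast_natCast (R := ℤ), Int.cast_id, ← PadicInt.pow_p_dvd_int_iff]
  have hlin : ∀ y, 0 < y → (p : ℤ_[p]) ^ r ∣ (n.choose y : ℤ_[p]) * y := by
    intro y hy
    obtain ⟨z, rfl⟩ : ∃ z, y = z + 1 := ⟨y - 1, by omega⟩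
    rcases Nat.eq_zero_or_pos n with rfl | hn0
    · simp
    obtain ⟨k, rfl⟩ : ∃ k, n = k + 1 := ⟨n - 1, by omega⟩
    have h1 := Nat.add_one_mul_choose_eq k z
    have h2 : (((k + 1).choose (z + 1) : ℕ) : ℤ_[p]) * (z + 1 : ℕ) =
        ((k + 1 : ℕ) : ℤ_[p]) * k.choose z := by exact_mod_cast h1.symm
    rw [h2]
    exact Dvd.dvd.mul_right (by exact_mod_cast Nat.cast_dvd_cast (α := ℤ_[p]) hn) _
  have hcu : (p : ℤ_[p]) ^ t ∣ (u : ℤ_[p]) := by exact_mod_cast Nat.cast_dvd_cast (α := ℤ_[p]) hu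
  have hcv : (p : ℤ_[p]) ^ t ∣ (v : ℤ_[p]) := by exact_mod_cast Nat.cast_dvd_cast (α := ℤ_[p]) hv
  -- From $\binom ua = \frac{u}{u-a}\binom{u-1}{a}$ and $\binom{w}{v-a} =
  -- \frac{w}{v-a}\binom{w-1}{v-1-a}$. The numerators $u$, $w$ combine with $\binom nu$, $\binom nw$
  -- to give $p^{2r}$ by `hlin`; the denominators are units, and `D a` is `altInvSq p a` modulo
  -- $p^t$.
  set D : ℕ → ℤ_[p] := fun a => if p ∣ a then 0 else (-1) ^ a *
    (Ring.inverse ((u : ℤ_[p]) - a) * Ring.inverse ((v : ℤ_[p]) - a)) with hD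
  have hunit : ∀ (y a : ℕ), p ^ t ∣ y → ¬ p ∣ a → IsUnit ((y : ℤ_[p]) - a) := by
    intro y a hy ha
    have : ((y : ℤ_[p]) - a) = ((y - a : ℤ) : ℤ_[p]) := by push_cast; rfl
    rw [this]
    have h1 : ¬ (p : ℤ) ∣ (y - a : ℤ) := fun h => ha <| by
      have h2 : (p : ℤ) ∣ y := by exact_mod_cast hpt.trans hy
      have := dvd_sub h2 h
      rw [sub_sub_cancel] at this
      exact_mod_cast this
    exact isUnit_intCast_padicInt h1
  have hDsub : ∀ a, (p : ℤ_[p]) ^ t ∣ D a - altInvSq p a := by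
    intro a
    by_cases ha : p ∣ a
    · simp [hD, altInvSq, ha]
    · simp only [hD, altInvSq, if_neg ha]
      have ia := Ring.mul_inverse_cancel _ (isUnit_natCast_padicInt ha)
      have iu := Ring.mul_inverse_cancel _ (hunit u a hu ha)
      have iv := Ring.mul_inverse_cancel _ (hunit v a hv ha)
      set A := Ring.inverse (a : ℤ_[p])
      set B := Ring.inverse ((u : ℤ_[p]) - a)
      set C := Ring.inverse ((v : ℤ_[p]) - a)
      have hB : B = u * (A * B) - A := by linear_combination (-A) * iu - B * ia
      have hC : C = v * (A * C) - A := by linear_combination (-A) * iv - C * ia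
      have : (-1) ^ a * (B * C) - (-1) ^ a * A ^ 2 =
          u * ((-1) ^ a * A * B * C) - v * ((-1) ^ a * A * A * C) := by
        linear_combination ((-1) ^ a * C) * hB - (-1) ^ a * A * hC
      rw [this]
      exact dvd_sub (hcu.mul_right _) (hcv.mul_right _)
  have hmain : (p : ℤ_[p]) ^ t ∣ ∑ a ∈ Finset.range v,
      ((u - 1).choose a * (w - 1).choose (v - 1 - a) : ℤ_[p]) * D a := by
    have h1 := pow_dvd_sum_choose_mul p hodd t 0 u w v (altInvSq p) hu0 hw0 hu hw hv
      fun j _ c => by rw [zero_add]; exact pow_dvd_sum_altInvSq p hodd j c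
    rw [zero_add] at h1
    have h2 : (p : ℤ_[p]) ^ t ∣ ∑ a ∈ Finset.range v,
      ((u - 1).choose a * (w - 1).choose (v - 1 - a) : ℤ_[p]) * (D a - altInvSq p a) :=
      Finset.dvd_sum fun a _ => (hDsub a).mul_left _
    have h3 := dvd_add h2 h1
    rw [← Finset.sum_add_distrib] at h3
    convert h3 using 2
    ring
  have hfinal := mul_dvd_mul (mul_dvd_mul (hlin u hu0) (hlin w hw0)) hmain
  rw [← pow_add, ← pow_add, ← two_mul] at hfinal
  convert hfinal using 1
  push_cast
  rw [Finset.sum_range_succ, if_pos (hpt.trans hv), add_zero, Finset.mul_sum, Finset.mul_sum]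
  refine Finset.sum_congr rfl fun a ha => ?_
  rw [Finset.mem_range] at ha
  simp only [hD]
  by_cases hpa : p ∣ a
  · simp [hpa]
  simp only [if_neg hpa]
  have iu := Ring.mul_inverse_cancel _ (hunit u a hu hpa)
  have iv := Ring.mul_inverse_cancel _ (hunit v a hv hpa)
  set B := Ring.inverse ((u : ℤ_[p]) - a)
  set C := Ring.inverse ((v : ℤ_[p]) - a)
  have e1 : (u.choose a : ℤ_[p]) * (u - a) = u * (u - 1).choose a := by
    obtain ⟨z, rfl⟩ : ∃ z, u = z + 1 := ⟨u - 1, by omega⟩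
    rcases le_or_gt a (z + 1) with h | h
    · have := Nat.choose_mul_succ_eq z a
      have h3 : ((z.choose a : ℕ) : ℤ_[p]) * ((z + 1 : ℕ) : ℤ_[p]) =
        (((z + 1).choose a : ℕ) : ℤ_[p]) * ((z + 1 - a : ℕ) : ℤ_[p]) := by exact_mod_cast this
      rw [Nat.cast_sub h] at h3
      rw [Nat.add_sub_cancel, ← h3, mul_comm]
    · rw [Nat.choose_eq_zero_of_lt h, Nat.choose_eq_zero_of_lt (by omega)]
      simp
  have e2 : (w.choose (v - a) : ℤ_[p]) * (v - a) = w * (w - 1).choose (v - 1 - a) := by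
    obtain ⟨z, rfl⟩ : ∃ z, w = z + 1 := ⟨w - 1, by omega⟩
    obtain ⟨y, hy⟩ : ∃ y, v - a = y + 1 := ⟨v - a - 1, by omega⟩
    have := Nat.add_one_mul_choose_eq z y
    have h3 : ((z + 1 : ℕ) : ℤ_[p]) * (z.choose y : ℕ) =
      (((z + 1).choose (y + 1) : ℕ) : ℤ_[p]) * ((y + 1 : ℕ) : ℤ_[p]) := by exact_mod_cast this
    rw [show v - 1 - a = y by omega, Nat.add_sub_cancel, h3, hy, ← hy,
      Nat.cast_sub (by omega)]
  have e1' : (u.choose a : ℤ_[p]) = u * (u - 1).choose a * B := by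
    linear_combination (-(u.choose a : ℤ_[p])) * iu + B * e1
  have e2' : (w.choose (v - a) : ℤ_[p]) = w * (w - 1).choose (v - 1 - a) * C := by
    linear_combination (-(w.choose (v - a) : ℤ_[p])) * iv + C * e2
  rw [e1', e2']
  ring

/-! ### Coefficients of powers of a single row: divisibility and scaling by p. -/

open MvPolynomial in
/-- The coefficients of the powers of the linear forms `confForm k`. -/
noncomputable def rowCoeff (k : Fin 4) (n : ℕ) (d : Fin 4 →₀ ℕ) : ℤ := coeff d (confForm k ^ n)

theorem rowCoeff_eq (k : Fin 4) (n : ℕ) (d : Fin 4 →₀ ℕ) :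
    rowCoeff k n d = if ∑ i, d i = n then
      (Nat.multinomial Finset.univ d : ℤ) * ∏ i, confSign k i ^ d i else 0 := by
  rw [rowCoeff, confForm, MvPolynomial.coeff_linearCombination_X_pow_of_fintype,
    Finsupp.sum_fintype _ _ (by simp), Finsupp.prod_fintype _ _ (by simp),
    Finsupp.multinomial_eq_of_support_subset (Finset.subset_univ _)]

theorem rowCoeff_eq_zero_of_sum_ne {k : Fin 4} {n : ℕ} {d : Fin 4 →₀ ℕ} (h : ∑ i, d i ≠ n) :
    rowCoeff k n d = 0 := by
  rw [rowCoeff_eq, if_neg h]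

theorem confSign_self (k : Fin 4) : confSign k k = 0 := by
  revert k; decide

theorem rowCoeff_eq_zero_of_diag {k : Fin 4} {n : ℕ} {d : Fin 4 →₀ ℕ} (h : d k ≠ 0) :
    rowCoeff k n d = 0 := by
  rw [rowCoeff_eq]
  split_ifs
  · rw [Finset.prod_eq_zero (Finset.mem_univ k), mul_zero]
    rw [confSign_self, zero_pow h]
  · rfl

/-- Absorption: $d_j\binom{n}{d_j} = n\binom{n-1}{d_j-1}$, and the multinomial coefficient has
$\binom{n}{d_j}$ as a factor. -/
theorem dvd_apply_mul_rowCoeff (k : Fin 4) (n : ℕ) (d : Fin 4 →₀ ℕ) (j : Fin 4) :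
    (n : ℤ) ∣ d j * rowCoeff k n d := by
  rw [rowCoeff_eq]
  split_ifs with h
  · rw [← mul_assoc]
    refine Dvd.dvd.mul_right ?_ _
    rw [← Finset.insert_erase (Finset.mem_univ j), Nat.multinomial_insert (Finset.notMem_erase _ _),
      Finset.add_sum_erase _ _ (Finset.mem_univ j), h]
    rcases Nat.eq_zero_or_pos (d j) with h0 | h0
    · simp [h0]
    obtain ⟨z, hz⟩ : ∃ z, d j = z + 1 := ⟨d j - 1, by omega⟩
    rcases Nat.eq_zero_or_pos n with rfl | hn
    · rw [Nat.choose_eq_zero_of_lt h0]; simp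
    obtain ⟨q, rfl⟩ : ∃ q, n = q + 1 := ⟨n - 1, by omega⟩
    have := Nat.add_one_mul_choose_eq q z
    rw [hz]
    refine ⟨q.choose z * Nat.multinomial (Finset.univ.erase j) d, ?_⟩
    push_cast
    zify at this
    linear_combination -(Nat.multinomial (Finset.univ.erase j) d : ℤ) * this
  · simp

theorem Prime.pow_sub_dvd_of_pow_dvd_mul {p : ℤ} (hp : Prime p) {x y : ℤ} {r e : ℕ}
    (h : p ^ r ∣ x * y) (hx : ¬ p ^ (e + 1) ∣ x) : p ^ (r - e) ∣ y := by
  induction e generalizing x r with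
  | zero =>
    rw [zero_add, pow_one] at hx
    exact hp.pow_dvd_of_dvd_mul_left _ hx h
  | succ e ih =>
    by_cases hpx : p ∣ x
    · obtain ⟨z, rfl⟩ := hpx
      have hz : ¬ p ^ (e + 1) ∣ z := fun hz => hx (by
        rw [_root_.pow_succ' p (e + 1)]; exact mul_dvd_mul_left _ hz)
      rcases Nat.eq_zero_or_pos r with rfl | hr
      · simp
      obtain ⟨q, rfl⟩ : ∃ q, r = q + 1 := ⟨r - 1, by omega⟩
      rw [_root_.pow_succ', mul_assoc] at h
      have := ih (Int.dvd_of_mul_dvd_mul_left hp.ne_zero h) hz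
      rwa [show q + 1 - (e + 1) = q - e by omega]
    · exact (pow_dvd_pow _ (Nat.sub_le _ _)).trans (hp.pow_dvd_of_dvd_mul_left _ hpx h)

/-- The least `p`-adic valuation of the entries of `d`, truncated at `r`. -/
noncomputable def minVal (p r : ℕ) (d : Fin 4 →₀ ℕ) : ℕ :=
  open Classical in Nat.findGreatest (fun e => ∀ j, p ^ e ∣ d j) r

theorem minVal_le (p r : ℕ) (d : Fin 4 →₀ ℕ) : minVal p r d ≤ r := Nat.findGreatest_le _

theorem pow_minVal_dvd (p r : ℕ) (d : Fin 4 →₀ ℕ) (j : Fin 4) : p ^ minVal p r d ∣ d j := by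
  classical
  exact Nat.findGreatest_spec (P := fun e => ∀ j, p ^ e ∣ d j) (Nat.zero_le r) (by simp) j

/-- If `minVal` is below its cap $r$, some entry of `d` has exactly this valuation;
`dvd_apply_mul_rowCoeff` is used for that entry. -/
theorem pow_sub_minVal_dvd_rowCoeff (p : ℕ) (hp : p.Prime) {n r : ℕ} (hn : p ^ r ∣ n) (k : Fin 4)
    (d : Fin 4 →₀ ℕ) : (p : ℤ) ^ (r - minVal p r d) ∣ rowCoeff k n d := by
  classical
  rcases (minVal_le p r d).eq_or_lt with h | h
  · rw [h]; simp
  · have h1 : ¬ ∀ j, p ^ (minVal p r d + 1) ∣ d j := by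
      have := Nat.findGreatest_is_greatest (P := fun e => ∀ j, p ^ e ∣ d j)
        (show minVal p r d < minVal p r d + 1 by omega) h
      exact this
    push Not at h1
    obtain ⟨j, hj⟩ := h1
    have hn' : (p : ℤ) ^ r ∣ n := by exact_mod_cast hn
    exact Prime.pow_sub_dvd_of_pow_dvd_mul (Nat.prime_iff_prime_int.1 hp)
      (hn'.trans (dvd_apply_mul_rowCoeff k n d j)) (by exact_mod_cast hj)

theorem pow_dvd_rowCoeff_of_not_dvd (p : ℕ) (hp : p.Prime) {n r : ℕ} (hn : p ^ r ∣ n) (k : Fin 4)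
    (d : Fin 4 →₀ ℕ) (hd : ¬ ∀ j, p ∣ d j) : (p : ℤ) ^ r ∣ rowCoeff k n d := by
  push Not at hd
  obtain ⟨j, hj⟩ := hd
  have hn' : (p : ℤ) ^ r ∣ n := by exact_mod_cast hn
  exact (Nat.prime_iff_prime_int.1 hp).pow_dvd_of_dvd_mul_left _ (by exact_mod_cast hj)
      (hn'.trans (dvd_apply_mul_rowCoeff k n d j))

theorem confSign_pow_mul (p : ℕ) (hodd : Odd p) (k i : Fin 4) (e : ℕ) :
    confSign k i ^ (p * e) = confSign k i ^ e := by
  have h : confSign k i = 0 ∨ confSign k i = 1 ∨ confSign k i = -1 := by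
    revert k i; decide
  have hp : p ≠ 0 := by rintro rfl; exact absurd hodd (by decide)
  rw [pow_mul]
  congr 1
  rcases h with h | h | h <;> rw [h]
  · exact zero_pow hp
  · exact one_pow _
  · exact hodd.neg_one_pow

/-- By `factorial_mul_eq` the multinomial coefficients differ by a quotient of products of integers
prime to $p$; the powers of $p$ cancel because the entries sum to $n$, and signs persist because $p$
is odd. -/
theorem rowCoeff_nsmul_mul (p : ℕ) (hp : p.Prime) (hodd : Odd p) (k : Fin 4) (n : ℕ)
    (d : Fin 4 →₀ ℕ) :
    rowCoeff k (p * n) (p • d) * ∏ i, coprimeFactorial p (d i) =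
      rowCoeff k n d * coprimeFactorial p n := by
  rw [rowCoeff_eq, rowCoeff_eq]
  simp only [Finsupp.smul_apply, smul_eq_mul, ← Finset.mul_sum, confSign_pow_mul p hodd]
  by_cases h : ∑ i, d i = n
  · rw [if_pos h, if_pos (by rw [h])]
    have h1 := Nat.multinomial_spec Finset.univ d
    have h2 := Nat.multinomial_spec Finset.univ (p • d : Fin 4 →₀ ℕ)
    simp only [Finsupp.smul_apply, smul_eq_mul, ← Finset.mul_sum, h] at h1 h2
    zify at h1 h2
    simp only [factorial_mul_eq p hp.pos, Finset.prod_mul_distrib] at h2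
    rw [Finset.prod_pow_eq_pow_sum, h, ← h1] at h2
    have hne : (p : ℤ) ^ n * ∏ i, ((d i)! : ℤ) ≠ 0 := by
      refine mul_ne_zero (pow_ne_zero _ (by exact_mod_cast hp.ne_zero))
        (Finset.prod_ne_zero_iff.2 fun i _ => by exact_mod_cast Nat.factorial_ne_zero _)
    apply mul_left_cancel₀ hne
    rw [Finsupp.coe_smul]
    linear_combination (∏ i, confSign k i ^ d i) * h2
  · rw [if_neg h, if_neg (fun h' => h (Nat.eq_of_mul_eq_mul_left hp.pos h'))]
    simp

/-- The column sum makes $x_{ij}$ divisible by $p$ to the power $\max(V_i,\min(V_k,V_l))$, and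
likewise for $k$, $l$. For the three-term congruence these exponents add up to at least
$V_i+V_j+V_k+V_l$ minus the largest of $V_j,V_k,V_l$. The factors $y$ supply $4r-V_i-V_j-V_k-V_l$,
and the largest is at most $r$. -/
theorem pow_dvd_mul_coprimeFactorial_sub (p : ℕ) (hp : p.Prime) (hp5 : 5 ≤ p) {r n : ℕ}
    (hn : p ^ r ∣ n) (i j k l : Fin 4) (x : Fin 4 → Fin 4 → ℕ) (y : Fin 4 → ℤ) (V : Fin 4 → ℕ)
    (hrow : x i j + x i k + x i l = n) (hj : x i j + x k j + x l j = n)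
    (hk : x i k + x j k + x l k = n) (hl : x i l + x j l + x k l = n)
    (hVr : ∀ a, V a ≤ r) (hV : ∀ a b, p ^ V a ∣ x a b)
    (hy : ∀ a, (p : ℤ) ^ (r - V a) ∣ y a) :
    (p : ℤ) ^ (3 * r + 3) ∣ y i * y j * y k * y l * (coprimeFactorial p n -
      coprimeFactorial p (x i j) * coprimeFactorial p (x i k) * coprimeFactorial p (x i l)) := by
  have hcol : ∀ a b c : Fin 4, x i a + x b a + x c a = n →
      p ^ max (V i) (min (V b) (V c)) ∣ x i a := by
    intro a b c h
    rcases max_choice (V i) (min (V b) (V c)) with hm | hm <;> rw [hm]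
    · exact hV i a
    · have h1 : p ^ min (V b) (V c) ∣ x b a + x c a :=
        dvd_add ((pow_dvd_pow p (min_le_left _ _)).trans (hV b a))
          ((pow_dvd_pow p (min_le_right _ _)).trans (hV c a))
      have h2 : p ^ min (V b) (V c) ∣ x i a + (x b a + x c a) := by
        rw [← add_assoc, h]
        exact (pow_dvd_pow p ((min_le_left _ _).trans (hVr b))).trans hn
      exact (Nat.dvd_add_left h1).1 h2
  have hmax : ∀ b c, max (V i) (min (V b) (V c)) ≤ r := fun b c =>
    max_le (hVr i) ((min_le_left _ _).trans (hVr b))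
  have h1 := coprimeFactorial_add_add p hp hp5 (hcol j k l hj) (hcol k j l hk) (hcol l j k hl)
    (s := r) (by rw [hrow]; exact hn) (hmax k l) (hmax j l) (hmax j k)
  rw [hrow] at h1
  have h2 := mul_dvd_mul (mul_dvd_mul (mul_dvd_mul (mul_dvd_mul (hy i) (hy j)) (hy k)) (hy l)) h1
  simp only [← pow_add] at h2
  refine (pow_dvd_pow _ ?_).trans h2
  have := hVr i
  have := hVr j
  have := hVr k
  have := hVr l
  omega

theorem pow_dvd_prod_rowCoeff_sub (p : ℕ) (hp : p.Prime) (hp5 : 5 ≤ p) {r n : ℕ}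
    (hn : p ^ r ∣ n) (x : Fin 4 → Fin 4 →₀ ℕ) (hx : ∑ i, x i = expFour n n n n) :
    (p : ℤ) ^ (3 * r + 3) ∣ ∏ k, rowCoeff k (p * n) (p • x k) - ∏ k, rowCoeff k n (x k) := by
  have hodd : Odd p := hp.odd_of_ne_two (by omega)
  by_cases h0 : ∀ k, x k k = 0
  swap
  · push Not at h0
    obtain ⟨k, hk⟩ := h0
    have h1 : ∏ k, rowCoeff k (p * n) (p • x k) = 0 :=
      Finset.prod_eq_zero (Finset.mem_univ k) (rowCoeff_eq_zero_of_diag (by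
        rw [Finsupp.smul_apply]
        exact smul_ne_zero hp.ne_zero hk))
    have h2 : ∏ k, rowCoeff k n (x k) = 0 :=
      Finset.prod_eq_zero (Finset.mem_univ k) (rowCoeff_eq_zero_of_diag hk)
    rw [h1, h2, sub_zero]
    exact dvd_zero _
  by_cases hs : ∀ k, ∑ i, x k i = n
  swap
  · push Not at hs
    obtain ⟨k, hk⟩ := hs
    have h1 : ∏ k, rowCoeff k (p * n) (p • x k) = 0 :=
      Finset.prod_eq_zero (Finset.mem_univ k) (rowCoeff_eq_zero_of_sum_ne (by
        simp only [Finsupp.smul_apply, smul_eq_mul, ← Finset.mul_sum]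
        exact fun h => hk (Nat.eq_of_mul_eq_mul_left hp.pos h)))
    have h2 : ∏ k, rowCoeff k n (x k) = 0 :=
      Finset.prod_eq_zero (Finset.mem_univ k) (rowCoeff_eq_zero_of_sum_ne hk)
    rw [h1, h2, sub_zero]
    exact dvd_zero _
  have hc : ∀ c, x 0 c + x 1 c + x 2 c + x 3 c = n := by
    intro c
    have := DFunLike.congr_fun hx c
    rw [Finsupp.finsetSum_apply, Fin.sum_univ_four] at this
    rw [this]
    fin_cases c <;> rfl
  simp only [Fin.sum_univ_four] at hs
  set y : Fin 4 → ℤ := fun k => rowCoeff k n (x k) with hy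
  set u : Fin 4 → ℤ := fun k => ∏ i, coprimeFactorial p (x k i) with hu
  have hmain : ∀ i, (p : ℤ) ^ (3 * r + 3) ∣
      y 0 * y 1 * y 2 * y 3 * (coprimeFactorial p n - u i) := by
    have key := fun i j k l => pow_dvd_mul_coprimeFactorial_sub p hp hp5 hn i j k l
      (fun a b => x a b) y (fun a => minVal p r (x a))
    have hΦ0 : coprimeFactorial p 0 = 1 := by simp [coprimeFactorial]
    have s0 := hs 0
    have s1 := hs 1
    have s2 := hs 2
    have s3 := hs 3
    have c0 := hc 0
    have c1 := hc 1
    have c2 := hc 2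
    have c3 := hc 3
    have d0 := h0 0
    have d1 := h0 1
    have d2 := h0 2
    have d3 := h0 3
    have hVr : ∀ a, minVal p r (x a) ≤ r := fun a => minVal_le _ _ _
    have hV : ∀ a b, p ^ minVal p r (x a) ∣ x a b := fun a b => pow_minVal_dvd _ _ _ _
    have hyV : ∀ a, (p : ℤ) ^ (r - minVal p r (x a)) ∣ y a := fun a =>
      pow_sub_minVal_dvd_rowCoeff p hp hn a (x a)
    intro i
    fin_cases i
    · have := key 0 1 2 3 (by omega) (by omega) (by omega) (by omega) hVr hV hyV
      convert this using 2
      simp only [hu, Fin.prod_univ_four]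
      simp [d0, hΦ0]
    · have := key 1 0 2 3 (by omega) (by omega) (by omega) (by omega) hVr hV hyV
      convert this using 2
      · ring
      · simp only [hu, Fin.prod_univ_four]
        simp [d1, hΦ0]
    · have := key 2 0 1 3 (by omega) (by omega) (by omega) (by omega) hVr hV hyV
      convert this using 2
      · ring
      · simp only [hu, Fin.prod_univ_four]
        simp [d2, hΦ0]
    · have := key 3 0 1 2 (by omega) (by omega) (by omega) (by omega) hVr hV hyV
      convert this using 2
      · ring
      · simp only [hu, Fin.prod_univ_four]
        simp [d3, hΦ0]
  have hpI := Nat.prime_iff_prime_int.1 hp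
  have hnd : ¬ (p : ℤ) ∣ u 0 * u 1 * u 2 * u 3 := by
    have hui : ∀ i, ¬ (p : ℤ) ∣ u i := fun i h => by
      obtain ⟨j, -, hj⟩ := (hpI.dvd_finsetProd_iff _).1 h
      exact not_dvd_coprimeFactorial p hp _ hj
    intro h
    rcases hpI.dvd_or_dvd h with h | h
    · rcases hpI.dvd_or_dvd h with h | h
      · rcases hpI.dvd_or_dvd h with h | h
        · exact hui _ h
        · exact hui _ h
      · exact hui _ h
    · exact hui _ h
  refine hpI.pow_dvd_of_dvd_mul_left _ hnd ?_
  have hrel := fun k => rowCoeff_nsmul_mul p hp hodd k n (x k)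
  have e0 := hrel 0
  have e1 := hrel 1
  have e2 := hrel 2
  have e3 := hrel 3
  set z : Fin 4 → ℤ := fun k => rowCoeff k (p * n) (p • x k) with hz
  set w := coprimeFactorial p n with hw
  change z 0 * u 0 = y 0 * w at e0
  change z 1 * u 1 = y 1 * w at e1
  change z 2 * u 2 = y 2 * w at e2
  change z 3 * u 3 = y 3 * w at e3
  rw [Fin.prod_univ_four, Fin.prod_univ_four]
  change _ ∣ u 0 * u 1 * u 2 * u 3 * (z 0 * z 1 * z 2 * z 3 - y 0 * y 1 * y 2 * y 3)
  have hprod : z 0 * u 0 * (z 1 * u 1) * (z 2 * u 2) * (z 3 * u 3) =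
      y 0 * w * (y 1 * w) * (y 2 * w) * (y 3 * w) := by rw [e0, e1, e2, e3]
  -- Telescoping of $w^4 - u_0u_1u_2u_3$, replacing one factor $w$ by $u_i$ at a time.
  have hsum := dvd_add (dvd_add (dvd_add ((hmain 0).mul_right (w ^ 3))
    ((hmain 1).mul_right (u 0 * w ^ 2))) ((hmain 2).mul_right (u 0 * u 1 * w)))
    ((hmain 3).mul_right (u 0 * u 1 * u 2))
  obtain ⟨q, hq⟩ := hsum
  exact ⟨q, by linear_combination hq + hprod⟩

/-! ### Signs of the conference matrix and the splitting of row powers. -/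

theorem univ_eq_of_pairwise_ne : ∀ i j k l : Fin 4, i ≠ j → i ≠ k → i ≠ l → j ≠ k → j ≠ l → k ≠ l →
    (Finset.univ : Finset (Fin 4)) = {i, j, k, l} := by decide

/-- Rows $k$ and $l$ are orthogonal, and their inner product has only the two nonzero terms at $i$
and $j$, which are therefore opposite. This creates the alternating sign in the sum for a pair of
rows. -/
theorem confSign_orthogonal (i j k l : Fin 4) (hij : i ≠ j) (hik : i ≠ k) (hil : i ≠ l)
    (hjk : j ≠ k) (hjl : j ≠ l) (hkl : k ≠ l) :
    confSign k i * confSign k j * confSign l i * confSign l j = -1 := by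
  have h : ∀ i j k l : Fin 4, (i ≠ j ∧ i ≠ k ∧ i ≠ l) ∧ j ≠ k ∧ j ≠ l ∧ k ≠ l →
    confSign k i * confSign k j * confSign l i * confSign l j = -1 := by decide
  exact h i j k l ⟨⟨hij, hik, hil⟩, hjk, hjl, hkl⟩

theorem confSign_sq : ∀ i k : Fin 4, i ≠ k → confSign k i ^ 2 = 1 := by decide

/-- The sum of a function over four distinct indices. -/
theorem sum_four {A : Type*} [AddCommMonoid A] {i j k l : Fin 4} (hij : i ≠ j) (hik : i ≠ k)
    (hil : i ≠ l) (hjk : j ≠ k) (hjl : j ≠ l) (hkl : k ≠ l) (f : Fin 4 → A) :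
    ∑ a, f a = f i + (f j + (f k + f l)) := by
  rw [univ_eq_of_pairwise_ne i j k l hij hik hil hjk hjl hkl, Finset.sum_insert (by simp [*]),
    Finset.sum_insert (by simp [*]), Finset.sum_insert (by simp [*]), Finset.sum_singleton]

theorem prod_four {A : Type*} [CommMonoid A] {i j k l : Fin 4} (hij : i ≠ j) (hik : i ≠ k)
    (hil : i ≠ l) (hjk : j ≠ k) (hjl : j ≠ l) (hkl : k ≠ l) (f : Fin 4 → A) :
    ∏ a, f a = f i * (f j * (f k * f l)) := by
  rw [univ_eq_of_pairwise_ne i j k l hij hik hil hjk hjl hkl, Finset.prod_insert (by simp [*]),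
    Finset.prod_insert (by simp [*]), Finset.prod_insert (by simp [*]), Finset.prod_singleton]

theorem rowCoeff_eq_choose {i j k l : Fin 4} (hij : i ≠ j) (hik : i ≠ k)
    (hil : i ≠ l) (hjk : j ≠ k) (hjl : j ≠ l) (hkl : k ≠ l) {n : ℕ} {d : Fin 4 →₀ ℕ}
    (hd : d k = 0) (hs : d i + d j + d l = n) :
    rowCoeff k n d = confSign k i ^ d i * confSign k j ^ d j * confSign k l ^ d l *
      (n.choose (d i + d j) * (d i + d j).choose (d i)) := by
  have hsum : ∑ a, d a = n := by
    rw [sum_four hij hik hil hjk hjl hkl, hd, ← hs]; ring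
  rw [rowCoeff_eq, if_pos hsum, prod_four hij hik hil hjk hjl hkl, hd, pow_zero]
  have h1 := Nat.multinomial_spec Finset.univ d
  rw [prod_four hij hik hil hjk hjl hkl, hsum, hd, Nat.factorial_zero] at h1
  have h2 := Nat.choose_mul_factorial_mul_factorial (show d i + d j ≤ n by omega)
  have h3 := Nat.choose_mul_factorial_mul_factorial (show d i ≤ d i + d j by omega)
  rw [show n - (d i + d j) = d l by omega] at h2
  rw [Nat.add_sub_cancel_left] at h3
  have h4 : Nat.multinomial Finset.univ d = n.choose (d i + d j) * (d i + d j).choose (d i) := by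
    have hpos : 0 < (d i)! * (d j)! * (d l)! := by positivity
    apply Nat.eq_of_mul_eq_mul_left hpos
    calc _ = (d i)! * ((d j)! * (1 * (d l)!)) * Nat.multinomial Finset.univ d := by ring
      _ = n.choose (d i + d j) * ((d i + d j).choose (d i) * (d i)! * (d j)!) * (d l)! := by
        rw [h1, h3, h2]
      _ = _ := by ring
  rw [h4]
  push_cast
  ring

open MvPolynomial in
/-- The part of `confForm k ^ (p * n)` supported on exponents divisible by `p`, with all exponents
divided by `p`. -/
noncomputable def rowSection (p : ℕ) (k : Fin 4) (n : ℕ) : MvPolynomial (Fin 4) ℤ :=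
  ∑ d ∈ Finset.finsuppAntidiag Finset.univ n, monomial d (rowCoeff k (p * n) (p • d))

open MvPolynomial in
theorem coeff_sum_finsuppAntidiag (n : ℕ) (f : (Fin 4 →₀ ℕ) → ℤ) (d : Fin 4 →₀ ℕ)
    (hf : ∑ i, d i ≠ n → f d = 0) :
    coeff d (∑ d ∈ Finset.finsuppAntidiag Finset.univ n, monomial d (f d)) = f d := by
  simp only [coeff_sum, coeff_monomial]
  rw [Finset.sum_ite_eq']
  split_ifs with h
  · rfl
  · refine (hf fun h' => h ?_).symm
    simpa using h'

open MvPolynomial in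
theorem coeff_rowSection (p : ℕ) (hp : p ≠ 0) (k : Fin 4) (n : ℕ) (d : Fin 4 →₀ ℕ) :
    coeff d (rowSection p k n) = rowCoeff k (p * n) (p • d) := by
  rw [rowSection, coeff_sum_finsuppAntidiag n (fun d => rowCoeff k (p * n) (p • d))]
  intro h
  refine rowCoeff_eq_zero_of_sum_ne ?_
  simp only [Finsupp.smul_apply, smul_eq_mul, ← Finset.mul_sum]
  exact fun h' => h (Nat.eq_of_mul_eq_mul_left (Nat.pos_of_ne_zero hp) h')

open MvPolynomial in
theorem confForm_pow_eq_sum (k : Fin 4) (n : ℕ) :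
    confForm k ^ n = ∑ d ∈ Finset.finsuppAntidiag Finset.univ n, monomial d (rowCoeff k n d) := by
  ext d
  rw [coeff_sum_finsuppAntidiag n (rowCoeff k n) d rowCoeff_eq_zero_of_sum_ne]
  rfl

open MvPolynomial in
theorem coeff_prod_sum_monomial (T : Finset (Fin 4 →₀ ℕ)) (f : Fin 4 → (Fin 4 →₀ ℕ) → ℤ)
    (D : Fin 4 →₀ ℕ) :
    coeff D (∏ k, ∑ d ∈ T, monomial d (f k d)) =
      ∑ x ∈ Fintype.piFinset (fun _ : Fin 4 => T), if ∑ k, x k = D then ∏ k, f k (x k) else 0 := by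
  rw [Finset.prod_univ_sum, coeff_sum]
  refine Finset.sum_congr rfl fun x _ => ?_
  rw [← monomial_sum_prod, coeff_monomial]

open MvPolynomial in
theorem pow_dvd_coeff_prod_rowSection_sub (p : ℕ) (hp : p.Prime) (hp5 : 5 ≤ p) {r n : ℕ}
    (hn : p ^ r ∣ n) : (p : ℤ) ^ (3 * r + 3) ∣
      coeff (expFour n n n n) (∏ k, rowSection p k n) - confCoeff (expFour n n n n) := by
  have h : confCoeff (expFour n n n n) = coeff (expFour n n n n) (∏ k, confForm k ^ n) := by
    rw [confCoeff]
    refine congrArg _ (Finset.prod_congr rfl fun k _ => ?_)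
    fin_cases k <;> rfl
  rw [h]
  simp only [confForm_pow_eq_sum, rowSection]
  rw [coeff_prod_sum_monomial, coeff_prod_sum_monomial, ← Finset.sum_sub_distrib]
  refine Finset.dvd_sum fun x _ => ?_
  split_ifs with hx
  · exact pow_dvd_prod_rowCoeff_sub p hp hp5 hn x hx
  · simp

open MvPolynomial in
/-- The part of `confForm k ^ (p * n)` supported on exponents not divisible by `p`. -/
noncomputable def rowRest (p : ℕ) (k : Fin 4) (n : ℕ) : MvPolynomial (Fin 4) ℤ :=
  confForm k ^ (p * n) - expand p (rowSection p k n)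

open MvPolynomial in
theorem coeff_expand_rowSection (p : ℕ) (hp : p ≠ 0) (k : Fin 4) (n : ℕ) (d : Fin 4 →₀ ℕ) :
    coeff d (expand p (rowSection p k n)) =
      if ∀ j, p ∣ d j then rowCoeff k (p * n) d else 0 := by
  split_ifs with h
  · choose e he using h
    have hd : d = p • (Finsupp.equivFunOnFinite.symm e) := by
      ext j
      rw [he j]
      rfl
    rw [hd, coeff_expand_smul p hp, coeff_rowSection p hp]
  · push Not at h
    obtain ⟨j, hj⟩ := h
    exact coeff_expand_of_not_dvd _ hj

open MvPolynomial in
theorem coeff_rowRest (p : ℕ) (hp : p ≠ 0) (k : Fin 4) (n : ℕ) (d : Fin 4 →₀ ℕ) :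
    coeff d (rowRest p k n) = if ∀ j, p ∣ d j then 0 else rowCoeff k (p * n) d := by
  rw [rowRest, coeff_sub, coeff_expand_rowSection p hp]
  split_ifs
  · exact sub_self _
  · exact sub_zero _

open MvPolynomial in
theorem pow_dvd_coeff_rowRest (p : ℕ) (hp : p.Prime) {r n : ℕ} (hn : p ^ r ∣ p * n) (k : Fin 4)
    (d : Fin 4 →₀ ℕ) : (p : ℤ) ^ r ∣ coeff d (rowRest p k n) := by
  rw [coeff_rowRest p hp.ne_zero]
  split_ifs with h
  · exact dvd_zero _
  · exact pow_dvd_rowCoeff_of_not_dvd p hp hn k d h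

theorem pow_sub_eq_pow_add_of_sq {x : ℤ} (hx : x ^ 2 = 1) {a b : ℕ} (h : b ≤ a) :
    x ^ (a - b) = x ^ (a + b) := by
  obtain ⟨c, rfl⟩ := Nat.exists_eq_add_of_le h
  rw [Nat.add_sub_cancel_left, show b + c + b = 2 * b + c by ring, pow_add, pow_mul, hx, one_pow,
    one_mul]

/-! ### Contributions of two, three or one rest rows, and the conclusion. -/

-- Since row $k$ lacks $X_k$ and row $l$ lacks $X_l$, fixing the total exponent leaves one
-- parameter: the exponent $a$ of $X_i$ in row $k$. For $t \ge 1$ belonging to the rest means $p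
-- \nmid a$, so the coefficient is, up to sign, the alternating sum of `pow_dvd_choose_mul_sum`. For
-- $t = 0$ the trivial bound suffices.
open MvPolynomial in
theorem pow_dvd_coeff_rowRest_mul (p : ℕ) (hp : p.Prime) (hodd : Odd p) {r n t : ℕ}
    (hn : p ^ r ∣ p * n) (htr : t ≤ r) {i j k l : Fin 4} (hij : i ≠ j) (hik : i ≠ k)
    (hil : i ≠ l) (hjk : j ≠ k) (hjl : j ≠ l) (hkl : k ≠ l) (x : Fin 4 →₀ ℕ)
    (hx : ∀ a, p ^ t ∣ x a) :
    (p : ℤ) ^ (2 * r + t) ∣ coeff x (rowRest p k n * rowRest p l n) := by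
  have : Fact p.Prime := ⟨hp⟩
  set N := p * n with hN
  rcases Nat.eq_zero_or_pos t with rfl | ht
  · rw [coeff_mul, add_zero, two_mul, pow_add]
    exact Finset.dvd_sum fun y _ => mul_dvd_mul (pow_dvd_coeff_rowRest p hp hn k _)
      (pow_dvd_coeff_rowRest p hp hn l _)
  have hpt : p ∣ p ^ t := dvd_pow_self p ht.ne'
  have hpN : p ∣ N := dvd_mul_right _ _
  have hS := fun (d : Fin 4 →₀ ℕ) => sum_four hij hik hil hjk hjl hkl (fun a => d a)
  have hnz : ∀ y ∈ Finset.HasAntidiagonal.antidiagonal x,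
      coeff y.1 (rowRest p k n) * coeff y.2 (rowRest p l n) ≠ 0 →
      y.1 k = 0 ∧ y.2 l = 0 ∧ y.1 i + y.1 j + y.1 l = N ∧ y.2 i + y.2 j + y.2 k = N ∧
        ¬ p ∣ y.1 i ∧ (∀ a, y.1 a + y.2 a = x a) := by
    rintro ⟨d, e⟩ hy hne
    rw [Finset.HasAntidiagonal.mem_antidiagonal] at hy
    dsimp only at hy hne ⊢
    have hde : ∀ a, d a + e a = x a := fun a => by rw [← hy]; rfl
    rw [coeff_rowRest p hp.ne_zero, coeff_rowRest p hp.ne_zero] at hne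
    split_ifs at hne with h1 h2
    · simp at hne
    · simp at hne
    · simp at hne
    have hd0 := left_ne_zero_of_mul hne
    have he0 := right_ne_zero_of_mul hne
    have hdk : d k = 0 := by by_contra h; exact hd0 (rowCoeff_eq_zero_of_diag h)
    have hel : e l = 0 := by by_contra h; exact he0 (rowCoeff_eq_zero_of_diag h)
    have hds : ∑ a, d a = N := by by_contra h; exact hd0 (rowCoeff_eq_zero_of_sum_ne h)
    have hes : ∑ a, e a = N := by by_contra h; exact he0 (rowCoeff_eq_zero_of_sum_ne h)
    rw [hS] at hds hes
    refine ⟨hdk, hel, by omega, by omega, fun hpi => h1 ?_, hde⟩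
    have hdl : p ∣ d l := by
      have := hde l
      rw [hel, add_zero] at this
      rw [this]
      exact hpt.trans (hx l)
    have hdj : p ∣ d j := by
      have h3 : p ∣ d j + (d i + d l) := by
        rw [show d j + (d i + d l) = N by omega]; exact hpN
      exact (Nat.dvd_add_left (dvd_add hpi hdl)).1 h3
    intro a
    have ha : a ∈ ({i, j, k, l} : Finset (Fin 4)) := by
      rw [← univ_eq_of_pairwise_ne i j k l hij hik hil hjk hjl hkl]; exact Finset.mem_univ a
    simp only [Finset.mem_insert, Finset.mem_singleton] at ha
    rcases ha with rfl | rfl | rfl | rfl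
    · exact hpi
    · exact hdj
    · rw [hdk]; exact dvd_zero _
    · exact hdl
  rw [coeff_mul]
  by_cases hall : ∀ y ∈ Finset.HasAntidiagonal.antidiagonal x,
      coeff y.1 (rowRest p k n) * coeff y.2 (rowRest p l n) = 0
  · rw [Finset.sum_eq_zero hall]
    exact dvd_zero _
  push Not at hall
  obtain ⟨y, hy, hne⟩ := hall
  obtain ⟨y1, y2, y3, y4, -, y6⟩ := hnz y hy hne
  have xk := y6 k
  have xl := y6 l
  have xi := y6 i
  have xj := y6 j
  set u := N - x l with hu
  set w := N - x k with hw
  have hul : u + x l = N := by omega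
  have hwk : w + x k = N := by omega
  have hij' : x i + x j = u + w := by omega
  clear_value u w
  clear xk xl xi xj y1 y2 y3 y4 y6 hy hne y
  have hptN : p ^ t ∣ N := (pow_dvd_pow p htr).trans hn
  have hpu : p ^ t ∣ u := (Nat.dvd_add_left (hx l)).1 (hul ▸ hptN)
  have hpw : p ^ t ∣ w := (Nat.dvd_add_left (hx k)).1 (hwk ▸ hptN)
  -- The signs independent of $a$. As entries square to 1, exponents such as $u-a$ may be replaced
  -- by $u+a$, and the rest is $(-1)^a$ by `confSign_orthogonal`.
  set σ : ℤ := confSign k j ^ u * confSign k l ^ x l * confSign l i ^ x i *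
    confSign l j ^ (w + x i) * confSign l k ^ x k with hσ
  set g : ℕ → ℤ := fun a => if p ∣ a then 0 else
    (-1) ^ a * ((u.choose a : ℤ) * w.choose (x i - a)) with hg
  have key : ∑ y ∈ Finset.HasAntidiagonal.antidiagonal x,
      coeff y.1 (rowRest p k n) * coeff y.2 (rowRest p l n) =
      σ * (N.choose u * N.choose w * ∑ a ∈ Finset.range (x i + 1), g a) := by
    rw [Finset.mul_sum, Finset.mul_sum]
    -- The discarded $a$ are multiples of $p$ or would give negative exponents, in which case a
    -- binomial coefficient vanishes.
    have hsub : ∑ a ∈ (Finset.range (x i + 1)).filter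
        (fun a => a ≤ u ∧ u - a ≤ x j ∧ ¬ p ∣ a), σ * (N.choose u * N.choose w * g a) =
        ∑ a ∈ Finset.range (x i + 1), σ * (N.choose u * N.choose w * g a) := by
      refine Finset.sum_subset (Finset.filter_subset _ _) fun a ha hna => ?_
      have h0 : g a = 0 := by
        simp only [hg]
        by_cases hpa : p ∣ a
        · simp [hpa]
        · rw [if_neg hpa]
          simp only [Finset.mem_filter, ha, true_and, hpa, not_false_iff, and_true, not_and,
            not_le] at hna
          rw [Finset.mem_range] at ha
          rcases le_or_gt a u with h | h
          · rw [Nat.choose_eq_zero_of_lt (show w < x i - a by have := hna h; omega)]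
            simp
          · rw [Nat.choose_eq_zero_of_lt h]
            simp
      rw [h0]; simp
    rw [← hsub]
    symm
    set dv : ℕ → Fin 4 →₀ ℕ := fun a => Finsupp.single i a + Finsupp.single j (u - a) +
      Finsupp.single l (x l) with hdv
    have dvi : ∀ a, dv a i = a := fun a => by simp [hdv, hij.symm, hil.symm]
    have dvj : ∀ a, dv a j = u - a := fun a => by
      simp [hdv, hij, hjl.symm]
    have dvk : ∀ a, dv a k = 0 := fun a => by
      simp [hdv, hik, hjk, hkl.symm]
    have dvl : ∀ a, dv a l = x l := fun a => by simp [hdv, hil, hjl]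
    have hcase : ∀ P : Fin 4 → Prop, P i → P j → P k → P l → ∀ a, P a := by
      intro P pi pj pk pl a
      have ha : a ∈ ({i, j, k, l} : Finset (Fin 4)) := by
        rw [← univ_eq_of_pairwise_ne i j k l hij hik hil hjk hjl hkl]; exact Finset.mem_univ a
      simp only [Finset.mem_insert, Finset.mem_singleton] at ha
      rcases ha with rfl | rfl | rfl | rfl <;> assumption
    have hle : ∀ a, a ≤ x i → u - a ≤ x j → dv a ≤ x := fun a h1 h2 =>
      hcase (fun b => dv a b ≤ x b) (by rw [dvi]; exact h1) (by rw [dvj]; exact h2)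
        (by rw [dvk]; exact Nat.zero_le _) (by rw [dvl])
    refine Finset.sum_of_injOn (fun a => (dv a, x - dv a)) ?_ ?_ ?_ ?_
    · intro a _ b _ hab
      have := DFunLike.congr_fun (Prod.mk.inj hab).1 i
      rwa [dvi, dvi] at this
    · intro a ha
      simp only [Finset.coe_filter, Finset.mem_range, Set.mem_ofPred_eq] at ha
      rw [Finset.mem_coe, Finset.HasAntidiagonal.mem_antidiagonal]
      exact add_tsub_cancel_of_le (hle a (by omega) ha.2.2.1)
    · rintro ⟨d, e⟩ hy hni
      by_contra hne
      obtain ⟨z1, z2, z3, z4, z5, z6⟩ := hnz _ hy hne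
      dsimp only at z1 z2 z3 z4 z5 z6
      have xk := z6 k
      have xl := z6 l
      have xi := z6 i
      have xj := z6 j
      refine hni ⟨d i, ?_, ?_⟩
      · simp only [Finset.coe_filter, Finset.mem_range, Set.mem_ofPred_eq]
        exact ⟨by omega, by omega, by omega, z5⟩
      · have hd : dv (d i) = d := by
          ext b
          revert b
          refine hcase _ (dvi _) ?_ ?_ ?_
          · rw [dvj]; omega
          · rw [dvk]; omega
          · rw [dvl]; omega
        have he : x - d = e := by
          ext b
          have := z6 b
          rw [Finsupp.tsub_apply]
          omega
        dsimp only
        rw [hd, he]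
    · intro a ha
      simp only [Finset.mem_filter, Finset.mem_range] at ha
      obtain ⟨ha1, ha2, ha3, ha4⟩ := ha
      have e1 : coeff (dv a) (rowRest p k n) = confSign k i ^ a * confSign k j ^ (u - a) *
          confSign k l ^ x l * (N.choose u * u.choose a) := by
        rw [coeff_rowRest p hp.ne_zero, if_neg fun h => ha4 (by have := h i; rwa [dvi] at this),
          rowCoeff_eq_choose hij hik hil hjk hjl hkl (dvk a)
            (by rw [dvi, dvj, dvl]; omega), dvi, dvj, dvl, show a + (u - a) = u by omega]
      have xi : (x - dv a) i = x i - a := by rw [Finsupp.tsub_apply, dvi]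
      have xj : (x - dv a) j = x j - (u - a) := by rw [Finsupp.tsub_apply, dvj]
      have xk : (x - dv a) k = x k := by rw [Finsupp.tsub_apply, dvk, Nat.sub_zero]
      have xl : (x - dv a) l = 0 := by rw [Finsupp.tsub_apply, dvl, Nat.sub_self]
      have e2 : coeff (x - dv a) (rowRest p l n) = confSign l i ^ (x i - a) *
          confSign l j ^ (w - (x i - a)) * confSign l k ^ x k *
            (N.choose w * w.choose (x i - a)) := by
        rw [coeff_rowRest p hp.ne_zero, if_neg fun h => ha4 ?_,
          rowCoeff_eq_choose hij hil hik hjl hjk hkl.symm xl (by rw [xi, xj, xk]; omega),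
          xi, xj, xk, show x i - a + (x j - (u - a)) = w by omega,
          show x j - (u - a) = w - (x i - a) by omega]
        have h1 := h i
        rw [xi] at h1
        have h2 := Nat.dvd_sub (hpt.trans (hx i)) h1
        rwa [show x i - (x i - a) = a by omega] at h2
      dsimp only
      rw [e1, e2]
      simp only [hg, if_neg ha4]
      have s1 := pow_sub_eq_pow_add_of_sq (confSign_sq j k hjk) ha2
      have s2 := pow_sub_eq_pow_add_of_sq (confSign_sq i l hil) (show a ≤ x i by omega)
      have s3 : confSign l j ^ (w - (x i - a)) = confSign l j ^ (w + x i + a) := by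
        rw [pow_sub_eq_pow_add_of_sq (confSign_sq j l hjl) (by omega), pow_add, pow_sub_eq_pow_add_of_sq
          (confSign_sq j l hjl) (by omega), ← pow_add]
        congr 1; ring
      have hor := confSign_orthogonal i j k l hij hik hil hjk hjl hkl
      rw [s1, s2, s3, ← hor, hσ]
      ring
  rw [key]
  exact (pow_dvd_choose_mul_sum p hodd (n := N) (u := u) (w := w) (v := x i) hn hpu hpw (hx i)
    ht.ne').mul_left σ

open MvPolynomial in
theorem pow_dvd_coeff_of_three_le_card (p : ℕ) (hp : p.Prime) {r n : ℕ} (hn : p ^ r ∣ p * n)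
    (s : Finset (Fin 4)) (hs : 3 ≤ s.card) (G : MvPolynomial (Fin 4) ℤ) (D : Fin 4 →₀ ℕ) :
    (p : ℤ) ^ (3 * r) ∣ coeff D ((∏ k ∈ s, rowRest p k n) * G) := by
  have h1 : ∏ _k ∈ s, (C ((p : ℤ) ^ r) : MvPolynomial (Fin 4) ℤ) ∣ ∏ k ∈ s, rowRest p k n :=
    Finset.prod_dvd_prod_of_dvd _ _ fun k _ => (C_dvd_iff_dvd_coeff _ _).2 fun d =>
      pow_dvd_coeff_rowRest p hp hn k d
  rw [Finset.prod_const, ← C_pow, ← pow_mul] at h1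
  have h2 := (C_dvd_iff_dvd_coeff _ _).1 (h1.mul_right G) D
  refine (pow_dvd_pow _ ?_).trans h2
  rw [mul_comm]
  exact Nat.mul_le_mul_left r hs

-- If the target exponent and that of the section part are divisible by $p$, so is the exponent left
-- to the single rest, where it does not occur.
open MvPolynomial in
theorem coeff_rowRest_mul_expand (p : ℕ) (hp : p ≠ 0) (k : Fin 4) (n : ℕ)
    (G : MvPolynomial (Fin 4) ℤ) (D : Fin 4 →₀ ℕ) (hD : ∀ j, p ∣ D j) :
    coeff D (rowRest p k n * expand p G) = 0 := by
  rw [coeff_mul]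
  refine Finset.sum_eq_zero fun y hy => ?_
  rw [Finset.HasAntidiagonal.mem_antidiagonal] at hy
  by_cases h : ∀ j, p ∣ y.2 j
  · rw [coeff_rowRest p hp, if_pos, zero_mul]
    intro j
    have := hD j
    rw [← hy] at this
    exact (Nat.dvd_add_left (h j)).1 this
  · push Not at h
    obtain ⟨j, hj⟩ := h
    rw [coeff_expand_of_not_dvd _ hj, mul_zero]

-- Let $v_1, v_2$ be the `minVal` of the two section exponents and $t$ their minimum. The exponent
-- left to the two rests is divisible by $p^t$, so the valuation is at least $(2r+t)+(r-v_1)+(r-v_2)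
-- = 4r-\max(v_1,v_2) \ge 3r$.
open MvPolynomial in
theorem pow_dvd_coeff_pair (p : ℕ) (hp : p.Prime) (hodd : Odd p) {r n : ℕ}
    (hn : p ^ r ∣ p * n) {i j k l : Fin 4} (hij : i ≠ j) (hik : i ≠ k)
    (hil : i ≠ l) (hjk : j ≠ k) (hjl : j ≠ l) (hkl : k ≠ l) (D : Fin 4 →₀ ℕ)
    (hD : ∀ a, p ^ r ∣ D a) :
    (p : ℤ) ^ (3 * r) ∣ coeff D (rowRest p k n * rowRest p l n *
      (expand p (rowSection p i n) * expand p (rowSection p j n))) := by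
  rw [coeff_mul]
  refine Finset.dvd_sum fun y hy => ?_
  rw [Finset.HasAntidiagonal.mem_antidiagonal] at hy
  rw [coeff_mul (expand p (rowSection p i n)), Finset.mul_sum]
  refine Finset.dvd_sum fun z hz => ?_
  rw [Finset.HasAntidiagonal.mem_antidiagonal] at hz
  have hE : ∀ (a : Fin 4) (d : Fin 4 →₀ ℕ), (p : ℤ) ^ (r - minVal p r d) ∣
      coeff d (expand p (rowSection p a n)) := by
    intro a d
    rw [coeff_expand_rowSection p hp.ne_zero]
    split_ifs
    · exact pow_sub_minVal_dvd_rowCoeff p hp hn a d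
    · exact dvd_zero _
  set t := min (minVal p r z.1) (minVal p r z.2) with ht
  have h1 : minVal p r z.1 ≤ r := minVal_le _ _ _
  have h2 : minVal p r z.2 ≤ r := minVal_le _ _ _
  have hx : ∀ a, p ^ t ∣ y.1 a := by
    intro a
    have h3 : p ^ t ∣ y.2 a := by
      rw [← hz, Finsupp.add_apply]
      exact dvd_add ((pow_dvd_pow p (min_le_left _ _)).trans (pow_minVal_dvd p r z.1 a))
        ((pow_dvd_pow p (min_le_right _ _)).trans (pow_minVal_dvd p r z.2 a))
    have h4 : p ^ t ∣ y.1 a + y.2 a := by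
      rw [← Finsupp.add_apply, hy]
      exact (pow_dvd_pow p (by omega)).trans (hD a)
    exact (Nat.dvd_add_left h3).1 h4
  have h5 := pow_dvd_coeff_rowRest_mul p hp hodd hn (by omega) hij hik hil hjk hjl hkl y.1 hx
  have h6 := mul_dvd_mul h5 (mul_dvd_mul (hE i z.1) (hE j z.2))
  rw [← pow_add, ← pow_add] at h6
  exact (pow_dvd_pow _ (by omega)).trans h6

open MvPolynomial in
theorem pow_dvd_confCoeff_sub_coeff_rowSection (p : ℕ) (hp : p.Prime) (hodd : Odd p) {r n : ℕ}
    (hn : p ^ r ∣ p * n) :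
    (p : ℤ) ^ (3 * r) ∣ confCoeff (expFour (p * n) (p * n) (p * n) (p * n)) -
      coeff (expFour n n n n) (∏ k, rowSection p k n) := by
  set D := expFour (p * n) (p * n) (p * n) (p * n) with hDdef
  have hDa : ∀ a, D a = p * n := fun a => by fin_cases a <;> rfl
  have hD : ∀ a, p ^ r ∣ D a := fun a => by rw [hDa]; exact hn
  have hD1 : ∀ a, p ∣ D a := fun a => by rw [hDa]; exact dvd_mul_right _ _
  have h1 : confCoeff D = coeff D (∏ k, (rowRest p k n + expand p (rowSection p k n))) := by
    rw [confCoeff]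
    refine congrArg _ (Finset.prod_congr rfl fun k _ => ?_)
    rw [hDa, rowRest, sub_add_cancel]
  have h2 : coeff (expFour n n n n) (∏ k, rowSection p k n) =
      coeff D (∏ k, expand p (rowSection p k n)) := by
    rw [← map_prod, hDdef, ← nsmul_expFour, coeff_expand_smul p hp.ne_zero]
  rw [h1, h2, Finset.prod_add, coeff_sum, Finset.powerset_univ,
    ← Finset.add_sum_erase _ _ (Finset.mem_univ ∅), Finset.prod_empty, one_mul,
    Finset.sdiff_empty, add_sub_cancel_left]
  refine Finset.dvd_sum fun s hs => ?_
  have hs0 : s ≠ ∅ := (Finset.mem_erase.1 hs).1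
  rcases le_or_gt 3 s.card with h3 | h3
  · exact pow_dvd_coeff_of_three_le_card p hp hn s h3 _ D
  have hpos : 0 < s.card := Finset.card_pos.2 (Finset.nonempty_iff_ne_empty.2 hs0)
  rcases (show s.card = 1 ∨ s.card = 2 by omega) with hc | hc
  · obtain ⟨k, rfl⟩ := Finset.card_eq_one.1 hc
    rw [Finset.prod_singleton, ← map_prod, coeff_rowRest_mul_expand p hp.ne_zero k n _ D hD1]
    exact dvd_zero _
  · have hc' : (Finset.univ \ s).card = 2 := by
      rw [Finset.card_sdiff_of_subset (Finset.subset_univ s), hc]; rfl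
    obtain ⟨k, l, hkl, hkl'⟩ := Finset.card_eq_two.1 hc
    obtain ⟨i, j, hij, hij'⟩ := Finset.card_eq_two.1 hc'
    have hmem : ∀ a ∈ ({i, j} : Finset (Fin 4)), ∀ b ∈ ({k, l} : Finset (Fin 4)), a ≠ b := by
      rw [← hij', ← hkl']
      rintro a ha b hb rfl
      exact (Finset.mem_sdiff.1 ha).2 hb
    rw [hij', hkl', Finset.prod_pair hkl, Finset.prod_pair hij]
    exact pow_dvd_coeff_pair p hp hodd hn hij (hmem i (by simp) k (by simp))
      (hmem i (by simp) l (by simp)) (hmem j (by simp) k (by simp)) (hmem j (by simp) l (by simp))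
      hkl D hD

theorem theorem1p2 (p : ℕ) (hp : p.Prime) (hp5 : 5 ≤ p) (m r : ℕ) (hm : 1 ≤ m) (hr : 1 ≤ r) :
    Adelta (m * p ^ r) ≡ Adelta (m * p ^ (r - 1)) [ZMOD ((p : ℤ) ^ (3 * r))] := by
  obtain ⟨q, rfl⟩ : ∃ q, r = q + 1 := ⟨r - 1, by omega⟩
  rw [Nat.add_sub_cancel]
  have hodd : Odd p := hp.odd_of_ne_two (by omega)
  set n := m * p ^ q with hn
  have hpn : m * p ^ (q + 1) = p * n := by rw [hn, _root_.pow_succ]; ring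
  rw [hpn, Adelta_eq_confCoeff, Adelta_eq_confCoeff, _root_.pow_mul (-1 : ℤ) p n, hodd.neg_one_pow]
  refine Int.ModEq.mul_left _ (Int.ModEq.symm ?_)
  rw [Int.modEq_iff_dvd]
  have h1 := pow_dvd_confCoeff_sub_coeff_rowSection p hp hodd (r := q + 1) (n := n)
    (by rw [← hpn]; exact dvd_mul_left _ _)
  -- Only $p^q \mid n$ is available here, but the exponent $3q+3$ is exactly $3(q+1)$.
  have h2 := pow_dvd_coeff_prod_rowSection_sub p hp hp5 (r := q) (n := n) (dvd_mul_left _ _)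
  rw [← sub_add_sub_cancel]
  exact dvd_add h1 h2
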